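/- Let $r,k\ge 1$ and $n\ge 0$ be integers. An $(r,k)$-parking function of length $n$ is a sequence $(a_1,\dots,a_n)$ of positive integers whose increasing rearrangement $b_1\le\cdots\le b_n$ satisfies $b_i\le k+(i-1)r$ for all $i$. The symmetric group $\mathfrak S_n$ acts on the set $\mathrm{PF}_n^{(r,k)}$ of these sequences by permuting coordinates; let $$F_n^{(r,k)}=\frac1{n!}\sum_{w\in\mathfrak S_n}\#\{\alpha\in\mathrm{PF}_n^{(r,k)}: w\cdot\alpha=\alpha\}\;p_{\rho(w)}$$ be the Frobenius characteristic of this action, where $\rho(w)$ is the cycle type of $w$. Let $h_\lambda, e_\lambda, m_\lambda, s_\lambda, p_\lambda$ be the complete homogeneous, elementary, monomial, Schur and power sum symmetric functions over $\mathbb Q$ in infinitely many variables, and let $\omega$ be the algebra endomorphism of the ring of symmetric functions with $\omega(e_j)=h_j$ for all $j\ge1$. For a partition $\lambda\vdash n$ with parts $\lambda_1,\lambda_2,\dots$ let $d_i(\lambda)$ be the number of parts equal to $i$, $\ell(\lambda)$ the number of parts, $\varepsilon_\lambda=(-1)^{n-\ell(\lambda)}$ and $z_\lambda=\prod_i i^{d_i(\lambda)}d_i(\lambda)!$.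 Write $\binom{K}{d_1,\dots,d_n,\,K-\sum d_i}=\frac{K(K-1)\cdots(K-\sum d_i+1)}{d_1!\cdots d_n!}$, and let $s_\lambda(1^N)$ be the value of $s_\lambda$ when $N$ variables are set to $1$ and all others to $0$. Then $F_0^{(r,k)}=1$, and for every $n\ge1$ \begin{align*} F_n^{(r,k)} &= \frac{k}{rn+k}\sum_{\lambda\vdash n}\binom{rn+k}{d_1(\lambda),\dots,d_n(\lambda),\,rn+k-\ell(\lambda)}h_\lambda\\ &= \frac{k}{rn+k}\sum_{\lambda\vdash n}\varepsilon_\lambda\binom{rn+k+\ell(\lambda)-1}{d_1(\lambda),\dots,d_n(\lambda),\,rn+k-1}e_\lambda\\ &= \frac{k}{rn+k}\sum_{\lambda\vdash n}\Big[\prod_i\binom{\lambda_i+rn+k-1}{\lambda_i}\Big]m_\lambda\\ &= \frac{k}{rn+k}\sum_{\lambda\vdash n}s_\lambda(1^{rn+k})\,s_\lambda\\ &= k\sum_{\lambda\vdash n}z_\lambda^{-1}(rn+k)^{\ell(\lambda)-1}p_\lambda,\\ \omega F_n^{(r,k)} &= \frac{k}{rn+k}\sum_{\lambda\vdash n}\Big[\prod_i\binom{rn+k}{\lambda_i}\Big]m_\lambda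 . \end{align*} Moreover, for every $n\ge 0$, $$F_n^{(r,k)}=\frac{k}{rn+k}\,[t^n]H(t)^{rn+k},\qquad H(t)=\sum_{j\ge0}h_jt^j .$$ -/

import Mathlib

namespace ParkingFunctions
noncomputable section

/-! ### The ring of symmetric functions -/

/-- The ring `Λ` of symmetric functions over `ℚ`: the formal power series of bounded degree in
the variables `x₀, x₁, x₂, …` that are invariant under all permutations of the variables. -/
def SymFun : Subalgebra ℚ (MvPowerSeries ℕ ℚ) where
  carrier := {f | (∀ σ : Equiv.Perm ℕ, MvPowerSeries.renameEquiv ℚ σ f = f) ∧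
    ∃ N : ℕ, ∀ d : ℕ →₀ ℕ, N < d.degree → MvPowerSeries.coeff d f = 0}
  mul_mem' := by
    classical
    rintro f g ⟨hf, N, hN⟩ ⟨hg, M, hM⟩
    refine ⟨fun σ => by rw [map_mul, hf, hg], N + M, fun d hd => ?_⟩
    rw [MvPowerSeries.coeff_mul]
    refine Finset.sum_eq_zero fun p hp => ?_
    have hp' := Finset.HasAntidiagonal.mem_antidiagonal.mp hp
    have hdeg : p.1.degree + p.2.degree = d.degree := by rw [← hp', map_add]
    rcases lt_or_ge N p.1.degree with h | h
    · rw [hN _ h, zero_mul]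
    · rw [hM _ (by omega), mul_zero]
  add_mem' := by
    rintro f g ⟨hf, N, hN⟩ ⟨hg, M, hM⟩
    refine ⟨fun σ => by rw [map_add, hf, hg], N + M, fun d hd => ?_⟩
    rw [map_add, hN _ (by omega), hM _ (by omega), add_zero]
  algebraMap_mem' := by
    classical
    intro c
    refine ⟨fun σ => AlgEquiv.commutes _ _, 0, fun d hd => ?_⟩
    rw [MvPowerSeries.algebraMap_apply, MvPowerSeries.coeff_C, if_neg]
    rintro rfl
    simp at hd

open Classical in
/-- The formal sum of all monomials `x ^ d` whose exponent vector `d` lies in `S`. -/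
def sumMonomials (S : Set (ℕ →₀ ℕ)) : MvPowerSeries ℕ ℚ :=
  fun d => if d ∈ S then 1 else 0

open Classical in
theorem coeff_sumMonomials (S : Set (ℕ →₀ ℕ)) (d : ℕ →₀ ℕ) :
    MvPowerSeries.coeff d (sumMonomials S) = if d ∈ S then 1 else 0 := rfl

theorem degree_embDomain {α β : Type} (σ : α ↪ β) (d : α →₀ ℕ) :
    (d.embDomain σ).degree = d.degree := by
  rw [Finsupp.embDomain_eq_mapDomain, Finsupp.degree_mapDomain]

theorem sumMonomials_mem (n : ℕ) (S : Set (ℕ →₀ ℕ))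
    (h₁ : ∀ (σ : Equiv.Perm ℕ) (d : ℕ →₀ ℕ), d ∈ S → d.embDomain σ.toEmbedding ∈ S)
    (h₂ : ∀ d ∈ S, d.degree = n) : sumMonomials S ∈ SymFun := by
  have hinv : ∀ (σ : Equiv.Perm ℕ) (d : ℕ →₀ ℕ),
      (d.embDomain σ.toEmbedding).embDomain σ.symm.toEmbedding = d := by
    intro σ d
    rw [Finsupp.embDomain_eq_mapDomain, Finsupp.embDomain_eq_mapDomain, ← Finsupp.mapDomain_comp]
    simp
  refine ⟨fun σ => ?_, n, fun d hd => ?_⟩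
  · ext d
    obtain ⟨d, rfl⟩ : ∃ d' : ℕ →₀ ℕ, d'.embDomain σ.toEmbedding = d :=
      ⟨d.embDomain σ.symm.toEmbedding, hinv σ.symm d⟩
    refine (MvPowerSeries.coeff_embDomain_rename σ.toEmbedding _ d).trans ?_
    rw [coeff_sumMonomials, coeff_sumMonomials]
    congr 1
    exact propext ⟨h₁ σ d, fun h => hinv σ d ▸ h₁ σ.symm _ h⟩
  · rw [coeff_sumMonomials, if_neg]
    intro h
    have := h₂ d h
    omega

/-- The monomial symmetric function `m_μ`: the sum of all distinct monomials whose multiset of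
nonzero exponents is the multiset of parts of `μ`. -/
def monomialSym {n : ℕ} (μ : n.Partition) : SymFun :=
  ⟨sumMonomials {d | d.support.val.map d = μ.parts}, sumMonomials_mem n _ (fun σ d hd => by
      have hd' : d.support.val.map d = μ.parts := hd
      change (d.embDomain σ.toEmbedding).support.val.map _ = μ.parts
      rw [← hd', Finsupp.support_embDomain, Finset.map_val, Multiset.map_map]
      exact Multiset.map_congr rfl fun i _ => Finsupp.embDomain_apply_self _ _ _) (fun d hd => by
      have hd' : d.support.val.map d = μ.parts := hd
      rw [← μ.parts_sum, ← hd']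
      rfl)⟩

/-- The elementary symmetric function `e_n`: the sum of all squarefree monomials of degree `n`. -/
def elemSym (n : ℕ) : SymFun :=
  ⟨sumMonomials {d | d.degree = n ∧ ∀ i, d i ≤ 1}, sumMonomials_mem n _ (fun σ d hd => by
      refine ⟨(degree_embDomain _ d).trans hd.1, fun i => ?_⟩
      rw [Finsupp.embDomain_eq_mapDomain]
      simpa [Finsupp.mapDomain_equiv_apply] using hd.2 (σ.symm i)) (fun d hd => hd.1)⟩

/-- The complete homogeneous symmetric function `h_n`: the sum of all monomials of degree `n`. -/
def homSym (n : ℕ) : SymFun :=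
  ⟨sumMonomials {d | d.degree = n}, sumMonomials_mem n _
      (fun _ d hd => (degree_embDomain _ d).trans hd) (fun _ hd => hd)⟩

/-- The power sum symmetric function `p_n = ∑ i, x_i ^ n` (only used for `n ≥ 1`). -/
def powSym (n : ℕ) : SymFun :=
  ⟨sumMonomials {d | ∃ i, d = Finsupp.single i n}, sumMonomials_mem n _ (by
      rintro σ d ⟨i, rfl⟩
      exact ⟨σ i, by simp⟩) (by
      rintro d ⟨i, rfl⟩
      simp)⟩

/-! ### `Λ` is freely generated by the `e_n`, and the involution `ω` -/

theorem coeff_perm (f : SymFun) (σ : Equiv.Perm ℕ) (d : ℕ →₀ ℕ) :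
    MvPowerSeries.coeff (d.embDomain σ.toEmbedding) (f : MvPowerSeries ℕ ℚ) =
      MvPowerSeries.coeff d (f : MvPowerSeries ℕ ℚ) := by
  have h := MvPowerSeries.coeff_embDomain_rename (R := ℚ) σ.toEmbedding f.1 d
  rw [← h]
  exact congrArg (MvPowerSeries.coeff (d.embDomain σ.toEmbedding)) (f.2.1 σ).symm

theorem exists_perm (d : ℕ →₀ ℕ) (N : ℕ) (hd : d.degree ≤ N) :
    ∃ (σ : Equiv.Perm ℕ) (c : Fin N →₀ ℕ),
      d.embDomain σ.toEmbedding = c.embDomain Fin.valEmbedding := by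
  have hcard : d.support.card ≤ N := by
    refine le_trans ?_ hd
    rw [Finset.card_eq_sum_ones]
    exact Finset.sum_le_sum fun i hi =>
      Nat.one_le_iff_ne_zero.mpr (Finsupp.mem_support_iff.mp hi)
  obtain ⟨σ, hσ⟩ := (Equiv.Perm.isMultiplyPretransitive ℕ d.support.card).exists_smul_eq
    (d.support.equivFin.symm.toEmbedding.trans (Function.Embedding.subtype _)) Fin.valEmbedding
  have hσ' : ∀ x ∈ d.support, σ x < N := by
    intro x hx
    have h := DFunLike.congr_fun hσ (d.support.equivFin ⟨x, hx⟩)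
    have h' : σ x = (d.support.equivFin ⟨x, hx⟩ : ℕ) := by simpa using h
    rw [h']
    exact lt_of_lt_of_le (Fin.is_lt _) hcard
  refine ⟨σ, (d.embDomain σ.toEmbedding).comapDomain Fin.valEmbedding
    Fin.valEmbedding.injective.injOn, ?_⟩
  rw [Finsupp.embDomain_comapDomain]
  intro j hj
  rw [Finsupp.support_embDomain, Finset.mem_coe, Finset.mem_map] at hj
  obtain ⟨x, hx, rfl⟩ := hj
  exact ⟨⟨σ x, hσ' x hx⟩, rfl⟩

theorem coeff_esymm (N n : ℕ) (d : Fin N →₀ ℕ) :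
    MvPolynomial.coeff d (MvPolynomial.esymm (Fin N) ℚ n) =
      MvPowerSeries.coeff (d.embDomain Fin.valEmbedding) (elemSym n : MvPowerSeries ℕ ℚ) := by
  classical
  have hsum : ∀ t : Finset (Fin N), ∀ i, (∑ j ∈ t, Finsupp.single j 1 : Fin N →₀ ℕ) i =
      if i ∈ t then 1 else 0 := by
    intro t i
    simp [Finsupp.finsetSum_apply, Finsupp.single_apply]
  have hmem : (d.embDomain Fin.valEmbedding ∈
      {d : ℕ →₀ ℕ | d.degree = n ∧ ∀ i, d i ≤ 1}) ↔ d.degree = n ∧ ∀ i, d i ≤ 1 := by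
    refine and_congr (by rw [degree_embDomain]) ⟨fun h i => ?_, fun h i => ?_⟩
    · have := h (i : ℕ)
      rw [show (i : ℕ) = (Fin.valEmbedding : Fin N ↪ ℕ) i from rfl,
        Finsupp.embDomain_apply_self] at this
      exact this
    · by_cases hi : i ∈ Set.range (Fin.valEmbedding : Fin N ↪ ℕ)
      · obtain ⟨j, rfl⟩ := hi
        rw [Finsupp.embDomain_apply_self]
        exact h j
      · rw [Finsupp.embDomain_of_notMem_range _ _ _ hi]
        exact zero_le_one
  rw [MvPolynomial.esymm_eq_sum_monomial, MvPolynomial.coeff_sum]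
  change _ = MvPowerSeries.coeff _ (sumMonomials _)
  rw [coeff_sumMonomials]
  simp only [hmem, MvPolynomial.coeff_monomial]
  split_ifs with h
  · have hd : ∑ j ∈ d.support, Finsupp.single j 1 = d := by
      ext i
      rw [hsum]
      have := h.2 i
      split_ifs with hi <;> rw [Finsupp.mem_support_iff] at hi <;> omega
    have hc : d.support.card = n := by
      rw [← h.1, Finset.card_eq_sum_ones]
      refine Finset.sum_congr rfl fun i hi => ?_
      have := h.2 i
      rw [Finsupp.mem_support_iff] at hi
      omega
    rw [Finset.sum_eq_single d.support]
    · rw [if_pos hd]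
    · intro t _ ht
      rw [if_neg]
      rintro rfl
      apply ht
      ext i
      rw [Finsupp.mem_support_iff, hsum]
      simp
    · intro hn
      exact absurd (Finset.mem_powersetCard.mpr ⟨Finset.subset_univ _, hc⟩) hn
  · refine Finset.sum_eq_zero fun t ht => if_neg ?_
    rintro rfl
    apply h
    refine ⟨?_, fun i => by rw [hsum]; split_ifs <;> simp⟩
    rw [map_sum]
    simpa using (Finset.mem_powersetCard.mp ht).2

/-- The substitution `X i ↦ e_{i+1}`. -/
def elemHom : MvPolynomial ℕ ℚ →ₐ[ℚ] SymFun := MvPolynomial.aeval fun i => elemSym (i + 1)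

theorem isHomogeneous_elemHom_monomial (v : ℕ →₀ ℕ) : ∀ c : ℚ,
    (elemHom (MvPolynomial.monomial v c) : MvPowerSeries ℕ ℚ).IsHomogeneous
      (Finsupp.weight (fun i : ℕ => i + 1) v) := by
  classical
  have hC : ∀ c : ℚ, (elemHom (MvPolynomial.monomial 0 c) :
      MvPowerSeries ℕ ℚ).IsHomogeneous 0 := by
    intro c d hd
    have h : (elemHom (MvPolynomial.monomial 0 c) : MvPowerSeries ℕ ℚ) =
        MvPowerSeries.C c := by
      change ((elemHom (MvPolynomial.C c) : SymFun) : MvPowerSeries ℕ ℚ) = _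
      rw [elemHom, MvPolynomial.aeval_C]
      rfl
    rw [h, MvPowerSeries.coeff_C] at hd
    have : d = 0 := by
      by_contra h0
      exact hd (if_neg h0)
    rw [this, map_zero]
  have hadd : ∀ (v w : ℕ →₀ ℕ) (c : ℚ), (elemHom (MvPolynomial.monomial (v + w) c) :
      MvPowerSeries ℕ ℚ) = (elemHom (MvPolynomial.monomial v c) : MvPowerSeries ℕ ℚ) *
        (elemHom (MvPolynomial.monomial w 1) : MvPowerSeries ℕ ℚ) := by
    intro v w c
    rw [← Subalgebra.coe_mul, ← map_mul, MvPolynomial.monomial_mul, mul_one]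
  have hX : ∀ i, (elemHom (MvPolynomial.monomial (Finsupp.single i 1) 1) :
      MvPowerSeries ℕ ℚ).IsHomogeneous (i + 1) := by
    intro i d hd
    have h : elemHom (MvPolynomial.monomial (Finsupp.single i 1) 1) = elemSym (i + 1) :=
      MvPolynomial.aeval_X _ i
    rw [h] at hd
    change MvPowerSeries.coeff d (sumMonomials _) ≠ 0 at hd
    rw [coeff_sumMonomials] at hd
    by_contra hne
    refine hd (if_neg fun h => hne ?_)
    rw [← h.1, Finsupp.degree_eq_weight_one]
    rfl
  induction v using Finsupp.induction_linear with
  | zero => simpa using hC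
  | add v w hv hw =>
    intro c
    rw [hadd, map_add]
    exact MvPowerSeries.IsHomogeneous.mul (hv c) (hw 1)
  | single i k =>
    induction k with
    | zero => simpa using hC
    | succ k ih =>
      intro c
      rw [Finsupp.single_add, hadd, map_add]
      refine MvPowerSeries.IsHomogeneous.mul (ih c) ?_
      rw [show Finsupp.weight (fun i : ℕ => i + 1) (Finsupp.single i 1) = i + 1 by
        simp [Finsupp.weight_single]]
      exact hX i

theorem coeff_elemHom_eq_zero {P : MvPolynomial ℕ ℚ} {n : ℕ}
    (hP : MvPolynomial.IsWeightedHomogeneous (fun i : ℕ => i + 1) P n) (d : ℕ →₀ ℕ)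
    (hd : d.degree ≠ n) : MvPowerSeries.coeff d (elemHom P : MvPowerSeries ℕ ℚ) = 0 := by
  rw [P.as_sum, map_sum, AddSubmonoidClass.coe_finsetSum, map_sum]
  refine Finset.sum_eq_zero fun v hv => ?_
  refine MvPowerSeries.IsHomogeneous.coeff_eq_zero (isHomogeneous_elemHom_monomial v _) ?_
  rwa [hP (MvPolynomial.mem_support_iff.mp hv)]

theorem killCompl_elemHom {N : ℕ} (Q : MvPolynomial (Fin N) ℚ) :
    MvPowerSeries.killCompl Fin.valEmbedding
      (elemHom (MvPolynomial.rename Fin.val Q) : MvPowerSeries ℕ ℚ) =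
      ((MvPolynomial.esymmAlgHom (Fin N) ℚ N Q : MvPolynomial (Fin N) ℚ) :
        MvPowerSeries (Fin N) ℚ) := by
  have h : ((MvPowerSeries.killCompl Fin.valEmbedding).comp
      (SymFun.val.comp (elemHom.comp (MvPolynomial.rename Fin.val)))) =
      (MvPolynomial.coeToMvPowerSeries.algHom ℚ).comp
        ((MvPolynomial.symmetricSubalgebra (Fin N) ℚ).val.comp
          (MvPolynomial.esymmAlgHom (Fin N) ℚ N)) := by
    apply MvPolynomial.algHom_ext
    intro i
    have h₁ : elemHom (MvPolynomial.rename Fin.val (MvPolynomial.X i)) =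
        elemSym ((i : ℕ) + 1) := by
      rw [MvPolynomial.rename_X]
      exact MvPolynomial.aeval_X _ _
    have h₂ : (MvPolynomial.esymmAlgHom (Fin N) ℚ N (MvPolynomial.X i) :
        MvPolynomial (Fin N) ℚ) = MvPolynomial.esymm (Fin N) ℚ ((i : ℕ) + 1) := by
      rw [MvPolynomial.esymmAlgHom_apply, MvPolynomial.aeval_X]
    simp only [AlgHom.comp_apply, Subalgebra.coe_val, h₁, h₂]
    ext d
    rw [MvPowerSeries.coeff_killCompl, ← coeff_esymm]
    simp
  simpa using DFunLike.congr_fun h Q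

theorem elemHom_injective : Function.Injective elemHom := by
  rw [injective_iff_map_eq_zero]
  intro P hP
  obtain ⟨N, hN⟩ : ∃ N, ∀ i ∈ P.vars, i < N :=
    ⟨P.vars.sup id + 1, fun i hi => Nat.lt_succ_of_le (Finset.le_sup (f := id) hi)⟩
  obtain ⟨Q, rfl⟩ := MvPolynomial.exists_rename_eq_of_vars_subset_range P (Fin.val : Fin N → ℕ)
    Fin.val_injective (fun i hi => ⟨⟨i, hN i hi⟩, rfl⟩)
  have h := killCompl_elemHom Q
  rw [hP, ZeroMemClass.coe_zero, map_zero] at h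
  have h' : MvPolynomial.esymmAlgHom (Fin N) ℚ N Q = 0 := by
    apply Subtype.ext
    apply MvPolynomial.coe_injective
    rw [← h]
    simp
  rw [(map_eq_zero_iff _ (MvPolynomial.esymmAlgHom_fin_injective ℚ le_rfl)).mp h', map_zero]

theorem elemHom_surjective : Function.Surjective elemHom := by
  intro f
  classical
  obtain ⟨N, hN⟩ := f.2.2
  -- `f` restricted to the first `N` variables
  obtain ⟨q, hq⟩ : ∃ q : MvPolynomial (Fin N) ℚ, (q : MvPowerSeries (Fin N) ℚ) =
      MvPowerSeries.killCompl Fin.valEmbedding (f : MvPowerSeries ℕ ℚ) := by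
    refine ⟨MvPowerSeries.truncTotal (N + 1)
      (MvPowerSeries.killCompl Fin.valEmbedding (f : MvPowerSeries ℕ ℚ)), ?_⟩
    ext d
    rw [MvPolynomial.coeff_coe, MvPowerSeries.coeff_truncTotal_eq_ite]
    split_ifs with h
    · rfl
    · rw [MvPowerSeries.coeff_killCompl, hN]
      rw [degree_embDomain]
      omega
  have hqc : ∀ d, MvPolynomial.coeff d q =
      MvPowerSeries.coeff (d.embDomain Fin.valEmbedding) (f : MvPowerSeries ℕ ℚ) := by
    intro d
    rw [← MvPolynomial.coeff_coe, hq, MvPowerSeries.coeff_killCompl]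
  have hqs : q.IsSymmetric := by
    intro τ
    ext d
    obtain ⟨d, rfl⟩ : ∃ d' : Fin N →₀ ℕ, d'.mapDomain τ = d :=
      ⟨d.mapDomain τ.symm, by rw [← Finsupp.mapDomain_comp]; simp⟩
    rw [MvPolynomial.coeff_rename_mapDomain _ τ.injective, hqc, hqc]
    rw [← coeff_perm f (τ.viaEmbedding Fin.valEmbedding) (d.embDomain _)]
    congr 2
    simp only [Finsupp.embDomain_eq_mapDomain, ← Finsupp.mapDomain_comp]
    congr 1
    ext i
    exact (Equiv.Perm.viaEmbedding_apply τ Fin.valEmbedding i)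
  obtain ⟨P, hP⟩ := (MvPolynomial.esymmAlgHom_fin_bijective ℚ N).2 ⟨q, hqs⟩
  have hfP := killCompl_elemHom P
  rw [hP, hq] at hfP
  set R := MvPolynomial.rename Fin.val P
  let w : ℕ → ℕ := fun i => i + 1
  have hcomp : ∀ d : ℕ →₀ ℕ, MvPowerSeries.coeff d (elemHom R : MvPowerSeries ℕ ℚ) =
      MvPowerSeries.coeff d (elemHom (MvPolynomial.weightedHomogeneousComponent w d.degree R) :
        MvPowerSeries ℕ ℚ) := by
    intro d
    have hfin := MvPolynomial.weightedHomogeneousComponent_finsupp (w := w) R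
    conv_lhs => rw [← MvPolynomial.sum_weightedHomogeneousComponent w R,
      finsum_eq_sum _ hfin, map_sum, AddSubmonoidClass.coe_finsetSum, map_sum]
    rw [Finset.sum_eq_single d.degree]
    · intro j _ hj
      exact coeff_elemHom_eq_zero
        (MvPolynomial.weightedHomogeneousComponent_isWeightedHomogeneous _ _) d hj.symm
    · intro hn
      have hn' := fun h => hn ((Set.Finite.mem_toFinset hfin).mpr h)
      replace hn' : MvPolynomial.weightedHomogeneousComponent w d.degree R = 0 := not_not.mp hn'
      rw [hn', map_zero, ZeroMemClass.coe_zero, map_zero]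
  refine ⟨∑ j ∈ Finset.range (N + 1), MvPolynomial.weightedHomogeneousComponent w j R, ?_⟩
  apply Subtype.ext
  ext d
  have hsum : MvPowerSeries.coeff d (elemHom (∑ j ∈ Finset.range (N + 1),
      MvPolynomial.weightedHomogeneousComponent w j R) : MvPowerSeries ℕ ℚ) =
      if d.degree ≤ N then MvPowerSeries.coeff d (elemHom R : MvPowerSeries ℕ ℚ) else 0 := by
    rw [map_sum, AddSubmonoidClass.coe_finsetSum, map_sum, hcomp]
    have hz : ∀ j, j ≠ d.degree → MvPowerSeries.coeff d
        (elemHom (MvPolynomial.weightedHomogeneousComponent w j R) : MvPowerSeries ℕ ℚ) = 0 :=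
      fun j hj => coeff_elemHom_eq_zero
        (MvPolynomial.weightedHomogeneousComponent_isWeightedHomogeneous _ _) d hj.symm
    split_ifs with h
    · refine Finset.sum_eq_single _ (fun j _ hj => hz j hj) fun hn => ?_
      exact absurd (Finset.mem_range.mpr (by omega)) hn
    · refine Finset.sum_eq_zero fun j hj => hz j ?_
      rw [Finset.mem_range] at hj
      omega
  rw [hsum]
  split_ifs with h
  · obtain ⟨σ, c, hc⟩ := exists_perm d N h
    rw [← coeff_perm _ σ, ← coeff_perm f σ, hc, ← MvPowerSeries.coeff_killCompl,
      ← MvPowerSeries.coeff_killCompl, hfP]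
  · exact (hN d (by omega)).symm

/-- `Λ = ℚ[e₁, e₂, …]`. -/
def elemEquiv : MvPolynomial ℕ ℚ ≃ₐ[ℚ] SymFun :=
  AlgEquiv.ofBijective elemHom ⟨elemHom_injective, elemHom_surjective⟩

/-- The involution `ω`: the algebra endomorphism of `Λ` determined by `ω(e_n) = h_n` for all
`n ≥ 1`. -/
def omega : SymFun →ₐ[ℚ] SymFun :=
  (MvPolynomial.aeval (fun i => homSym (i + 1)) : MvPolynomial ℕ ℚ →ₐ[ℚ] SymFun).comp
    (elemEquiv.symm : SymFun →ₐ[ℚ] MvPolynomial ℕ ℚ)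

theorem omega_elemSym {n : ℕ} (hn : 1 ≤ n) : omega (elemSym n) = homSym n := by
  obtain ⟨i, rfl⟩ : ∃ i, n = i + 1 := ⟨n - 1, by omega⟩
  have h : elemEquiv.symm (elemSym (i + 1)) = MvPolynomial.X i := by
    rw [AlgEquiv.symm_apply_eq]
    exact (MvPolynomial.aeval_X (R := ℚ) (fun i => elemSym (i + 1)) i).symm
  change MvPolynomial.aeval (R := ℚ) (fun i => homSym (i + 1)) (elemEquiv.symm (elemSym (i + 1))) = _
  rw [h, MvPolynomial.aeval_X]

/-! ### The classical bases -/

/-- `h_μ = h_{μ₁} h_{μ₂} ⋯`. -/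
def homPart {n : ℕ} (μ : n.Partition) : SymFun := (μ.parts.map homSym).prod

/-- `e_μ = e_{μ₁} e_{μ₂} ⋯`. -/
def elemPart {n : ℕ} (μ : n.Partition) : SymFun := (μ.parts.map elemSym).prod

/-- `p_μ = p_{μ₁} p_{μ₂} ⋯`. -/
def powPart {n : ℕ} (μ : n.Partition) : SymFun := (μ.parts.map powSym).prod

/-- The Young diagram whose row lengths are the parts of `μ` in decreasing order. -/
def diagram {n : ℕ} (μ : n.Partition) : YoungDiagram :=
  YoungDiagram.ofRowLens (μ.parts.sort (· ≥ ·)) (Multiset.pairwise_sort _ _).sortedGE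

/-- The Schur function `s_μ`, as a formal power series: the coefficient of `x ^ d` is the number of
semistandard Young tableaux of shape `μ` with exactly `d i` entries equal to `i` for all `i`.
(The entries of tableaux, like the variables, are indexed from `0`.) -/
def schur {n : ℕ} (μ : n.Partition) : MvPowerSeries ℕ ℚ := fun d =>
  (Nat.card {T : SemistandardYoungTableau (diagram μ) //
    ∀ i, ((diagram μ).cells.filter fun c => T c.1 c.2 = i).card = d i} : ℚ)

open Classical in
/-- The specialization `f(1^N)`: the first `N` variables are set to `1` and all others to `0`.
(For `f` of bounded degree the sum has finitely many nonzero terms.) -/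
def specOnes (N : ℕ) (f : MvPowerSeries ℕ ℚ) : ℚ :=
  ∑ᶠ d : ℕ →₀ ℕ, if d.support ⊆ Finset.range N then MvPowerSeries.coeff d f else 0

/-! ### Numerical invariants of partitions -/

/-- `d_i(μ)`, the number of parts of `μ` equal to `i`. -/
def mult {n : ℕ} (μ : n.Partition) (i : ℕ) : ℕ := μ.parts.count i

/-- `ℓ(μ)`, the number of parts of `μ`. -/
def len {n : ℕ} (μ : n.Partition) : ℕ := Multiset.card μ.parts

/-- `ε_μ = (-1)^{n - ℓ(μ)}`. -/
def sgn {n : ℕ} (μ : n.Partition) : ℚ := (-1) ^ (n - len μ)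

/-- `z_μ = 1^{d_1} d_1! 2^{d_2} d_2! ⋯`. -/
def zee {n : ℕ} (μ : n.Partition) : ℚ :=
  ∏ i ∈ Finset.Icc 1 n, (i : ℚ) ^ mult μ i * ((mult μ i).factorial : ℚ)

/-- The multinomial coefficient
`K (K - 1) ⋯ (K - (d_1 + ⋯ + d_n) + 1) / (d_1! ⋯ d_n!)`. -/
def multinomialCoeff (K n : ℕ) (d : ℕ → ℕ) : ℚ :=
  (K.descFactorial (∑ i ∈ Finset.Icc 1 n, d i) : ℚ) /
    ∏ i ∈ Finset.Icc 1 n, ((d i).factorial : ℚ)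

/-! ### Parking functions and the Frobenius characteristic -/

/-- The Frobenius characteristic `(1 / n!) ∑ w, Fix(w) p_{ρ(w)}` of an action of the symmetric
group `𝔖_n`, where `ρ(w)` is the cycle type of `w` (fixed points included). -/
def frobeniusChar (n : ℕ) (C : Type) [MulAction (Equiv.Perm (Fin n)) C] : SymFun :=
  (1 / (n.factorial : ℚ)) • ∑ w : Equiv.Perm (Fin n),
    (Nat.card (MulAction.fixedBy C w) : ℚ) • powPart w.partition

/-- The `(r, k)`-parking functions of length `n`: sequences `(a_1, …, a_n)` of positive integers
whose increasing rearrangement `b_1 ≤ ⋯ ≤ b_n` satisfies `b_i ≤ k + (i - 1) r`. -/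
def PF (r k n : ℕ) : Set (Fin n → ℕ) :=
  {a | (∀ i, 1 ≤ a i) ∧ ∀ i : Fin n, (a ∘ Tuple.sort a) i ≤ k + (i : ℕ) * r}

theorem comp_mem_PF {r k n : ℕ} {a : Fin n → ℕ} (ha : a ∈ PF r k n) (w : Equiv.Perm (Fin n)) :
    a ∘ w ∈ PF r k n := by
  refine ⟨fun i => ha.1 (w i), fun i => ?_⟩
  rw [Tuple.comp_perm_comp_sort_eq_comp_sort]
  exact ha.2 i

/-- `𝔖_n` acts on the `(r, k)`-parking functions by permuting coordinates. -/
instance instMulActionPF (r k n : ℕ) : MulAction (Equiv.Perm (Fin n)) (PF r k n) where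
  smul w a := ⟨fun i => a.1 (w⁻¹ i), comp_mem_PF a.2 w⁻¹⟩
  one_smul _ := rfl
  mul_smul v w a := by
    apply Subtype.ext
    funext i
    change a.1 ((v * w)⁻¹ i) = a.1 (w⁻¹ (v⁻¹ i))
    rw [mul_inv_rev, Equiv.Perm.mul_apply]

/-- `F_n^{(r,k)}`, the Frobenius characteristic of the action of `𝔖_n` on the `(r, k)`-parking
functions of length `n`. -/
def F (r k n : ℕ) : SymFun := frobeniusChar n (PF r k n)

/-- `H(t) = ∑ h_n t^n`. -/
def H : PowerSeries SymFun := PowerSeries.mk homSym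

end

end ParkingFunctions

namespace ParkingFunctions
noncomputable section

theorem sum_mult {n : ℕ} (μ : n.Partition) : ∑ i ∈ Finset.Icc 1 n, mult μ i = len μ := by
  rw [len, ← Multiset.toFinset_sum_count_eq]
  symm
  refine Finset.sum_subset (fun i hi => ?_) (fun i _ hi => ?_)
  · rw [Multiset.mem_toFinset] at hi
    exact Finset.mem_Icc.mpr ⟨μ.parts_pos hi, μ.le_of_mem_parts hi⟩
  · rw [Multiset.mem_toFinset] at hi
    exact Multiset.count_eq_zero_of_notMem hi

theorem prod_map_parts {M : Type*} [CommMonoid M] {n : ℕ} (μ : n.Partition) (f : ℕ → M) :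
    (μ.parts.map f).prod = ∏ i ∈ Finset.Icc 1 n, f i ^ mult μ i := by
  rw [Finset.prod_multiset_map_count]
  refine Finset.prod_subset (fun i hi => ?_) (fun i _ hi => ?_)
  · rw [Multiset.mem_toFinset] at hi
    exact Finset.mem_Icc.mpr ⟨μ.parts_pos hi, μ.le_of_mem_parts hi⟩
  · rw [Multiset.mem_toFinset] at hi
    rw [Multiset.count_eq_zero_of_notMem hi, pow_zero]

theorem countPerms_parts_mul {n : ℕ} (μ : n.Partition) :
    μ.parts.countPerms * ∏ i ∈ Finset.Icc 1 n, (mult μ i).factorial = (len μ).factorial := by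
  have h := Finsupp.multinomial_eq_of_support_subset (f := Multiset.toFinsupp μ.parts)
    (s := Finset.Icc 1 n) (fun i hi => by
      rw [Multiset.toFinsupp_support, Multiset.mem_toFinset] at hi
      exact Finset.mem_Icc.mpr ⟨μ.parts_pos hi, μ.le_of_mem_parts hi⟩)
  have h2 := Nat.multinomial_spec (Finset.Icc 1 n) (mult μ)
  rw [sum_mult] at h2
  rw [← h2, mul_comm, Multiset.countPerms, h]
  rfl

theorem coeff_pow_congr {R : Type*} [CommRing R] {A B : PowerSeries R} {n : ℕ}
    (h : ∀ j ≤ n, PowerSeries.coeff j A = PowerSeries.coeff j B) (l : ℕ) :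
    PowerSeries.coeff n (A ^ l) = PowerSeries.coeff n (B ^ l) := by
  have h1 : PowerSeries.X ^ (n + 1) ∣ A - B := by
    rw [PowerSeries.X_pow_dvd_iff]
    intro m hm
    rw [map_sub, h m (by omega), sub_self]
  have h2 := PowerSeries.X_pow_dvd_iff.mp (h1.trans (sub_dvd_pow_sub_pow A B l)) n (by omega)
  rwa [map_sub, sub_eq_zero] at h2

theorem prod_map_monomial {R : Type*} [CommRing R] (a : ℕ → R) (s : Multiset ℕ) :
    (s.map fun j => PowerSeries.monomial j (a j)).prod =
      PowerSeries.monomial s.sum (s.map a).prod := by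
  induction s using Multiset.induction_on with
  | empty => simp [PowerSeries.monomial_zero_eq_C_apply]
  | cons j s ih =>
    rw [Multiset.map_cons, Multiset.prod_cons, ih, Multiset.sum_cons, Multiset.map_cons,
      Multiset.prod_cons, PowerSeries.monomial_mul_monomial]

/-- The power of a series without constant term, expanded over partitions. -/
theorem coeff_pow_eq_sum_partition {R : Type*} [CommRing R] {A : PowerSeries R}
    (hA : PowerSeries.coeff 0 A = 0) (n l : ℕ) :
    PowerSeries.coeff n (A ^ l) = ∑ μ : n.Partition, if len μ = l then
      (μ.parts.countPerms : R) * (μ.parts.map fun j => PowerSeries.coeff j A).prod else 0 := by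
  have h1 : PowerSeries.coeff n (A ^ l) = PowerSeries.coeff n
      ((∑ j ∈ Finset.Icc 1 n, PowerSeries.monomial j (PowerSeries.coeff j A)) ^ l) := by
    refine coeff_pow_congr (fun j hj => ?_) l
    rw [map_sum]
    simp only [PowerSeries.coeff_monomial]
    rw [Finset.sum_ite_eq]
    split_ifs with h
    · rfl
    · rw [Finset.mem_Icc] at h
      obtain rfl : j = 0 := by omega
      exact hA
  rw [h1, Finset.sum_pow, map_sum, ← Finset.sum_filter]
  have h2 : ∀ k : Sym ℕ l, PowerSeries.coeff n ((k.val.countPerms : PowerSeries R) *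
      (k.val.map fun j => PowerSeries.monomial j (PowerSeries.coeff j A)).prod) =
      if k.val.sum = n then (k.val.countPerms : R) *
        (k.val.map fun j => PowerSeries.coeff j A).prod else 0 := by
    intro k
    rw [prod_map_monomial, ← nsmul_eq_mul, map_nsmul, PowerSeries.coeff_monomial]
    by_cases h : k.val.sum = n
    · rw [if_pos h, if_pos h.symm, nsmul_eq_mul]
    · rw [if_neg h, if_neg (Ne.symm h), smul_zero]
  rw [Finset.sum_congr rfl fun k _ => h2 k, ← Finset.sum_filter]
  symm
  refine Finset.sum_bij' (fun μ hμ => ⟨μ.parts, (Finset.mem_filter.mp hμ).2⟩)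
    (fun k hk => ⟨k.val, fun {i} hi => ?_, (Finset.mem_filter.mp hk).2⟩) ?_ ?_ ?_ ?_ ?_
  · exact (Finset.mem_Icc.mp
      (Finset.mem_sym_iff.mp (Finset.mem_filter.mp hk).1 i hi)).1
  · intro μ hμ
    exact Finset.mem_filter.mpr ⟨Finset.mem_sym_iff.mpr fun i hi =>
      Finset.mem_Icc.mpr ⟨μ.parts_pos hi, μ.le_of_mem_parts hi⟩, μ.parts_sum⟩
  · intro k hk
    exact Finset.mem_filter.mpr ⟨Finset.mem_univ _, k.2⟩
  · intro μ hμ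
    rfl
  · intro k hk
    rfl
  · intro μ hμ
    rfl

theorem len_le {n : ℕ} (μ : n.Partition) : len μ ≤ n := by
  have h := Multiset.card_nsmul_le_sum (s := μ.parts) (a := 1) fun i hi => μ.parts_pos hi
  rw [μ.parts_sum, smul_eq_mul, mul_one] at h
  exact h

/-- The composite of two series, expanded over partitions. -/
theorem coeff_subst_eq_sum_partition {R : Type*} [CommRing R] (f : PowerSeries R)
    {A : PowerSeries R} (hA : PowerSeries.coeff 0 A = 0) (n : ℕ) :
    PowerSeries.coeff n (f.subst A) = ∑ μ : n.Partition, PowerSeries.coeff (len μ) f *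
      ((μ.parts.countPerms : R) * (μ.parts.map fun j => PowerSeries.coeff j A).prod) := by
  have hs : PowerSeries.HasSubst A := PowerSeries.HasSubst.of_constantCoeff_zero' (by simpa using hA)
  rw [PowerSeries.coeff_subst' hs, finsum_eq_sum_of_support_subset (s := Finset.range (n + 1))]
  · simp only [coeff_pow_eq_sum_partition hA, smul_eq_mul, Finset.mul_sum]
    rw [Finset.sum_comm]
    refine Finset.sum_congr rfl fun μ _ => ?_
    simp only [mul_ite, mul_zero]
    rw [Finset.sum_ite_eq, if_pos]
    exact Finset.mem_range.mpr (Nat.lt_succ_of_le (len_le μ))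
  · intro l hl
    by_contra hn
    apply hl
    simp only [smul_eq_mul]
    rw [coeff_pow_eq_sum_partition hA, Finset.sum_eq_zero, mul_zero]
    intro μ _
    rw [if_neg]
    intro h
    have := len_le μ
    simp at hn
    omega

/-- `A` is the product `∏ i, φ (x_i t)`. -/
def IsVarProd (φ : PowerSeries ℚ) (A : PowerSeries SymFun) : Prop :=
  ∀ (n : ℕ) (d : ℕ →₀ ℕ), MvPowerSeries.coeff d ((PowerSeries.coeff n A : SymFun) : MvPowerSeries ℕ ℚ) =
    if d.degree = n then d.prod fun _ j => PowerSeries.coeff j φ else 0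

theorem sum_antidiagonal_prod (u v : ℕ → ℚ) (hu : u 0 = 1) (hv : v 0 = 1) (d : ℕ →₀ ℕ) :
    ∑ p ∈ Finset.HasAntidiagonal.antidiagonal d, (p.1.prod fun _ j => u j) * (p.2.prod fun _ j => v j) =
      d.prod fun _ j => ∑ q ∈ Finset.HasAntidiagonal.antidiagonal j, u q.1 * v q.2 := by
  classical
  have hp : ∀ p ∈ Finset.HasAntidiagonal.antidiagonal d, (p.1.prod fun _ j => u j) * (p.2.prod fun _ j => v j) =
      ∏ i ∈ d.support, u (p.1 i) * v (p.2 i) := by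
    intro p hp
    rw [Finset.HasAntidiagonal.mem_antidiagonal] at hp
    rw [Finset.prod_mul_distrib, Finsupp.prod_of_support_subset (s := d.support) _ _ _ (fun _ _ => hu),
      Finsupp.prod_of_support_subset (s := d.support) _ _ _ (fun _ _ => hv)]
    all_goals
      intro i hi
      rw [Finsupp.mem_support_iff] at hi ⊢
      rw [← hp, Finsupp.add_apply]
      omega
  rw [Finset.sum_congr rfl hp, Finsupp.prod, Finset.prod_sum]
  have hg : ∀ (g : (a : ℕ) → a ∈ d.support → ℕ × ℕ),
      ∀ i, Finsupp.indicator d.support (fun i hi => (g i hi).1) i =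
        if h : i ∈ d.support then (g i h).1 else 0 := by
    intro g i
    rw [Finsupp.indicator_apply]
  refine Finset.sum_bij' (fun p _ i _ => (p.1 i, p.2 i))
    (fun g _ => (Finsupp.indicator d.support fun i hi => (g i hi).1,
      Finsupp.indicator d.support fun i hi => (g i hi).2)) ?_ ?_ ?_ ?_ ?_
  · intro p hp
    rw [Finset.HasAntidiagonal.mem_antidiagonal] at hp
    rw [Finset.mem_pi]
    intro i _
    rw [Finset.HasAntidiagonal.mem_antidiagonal, ← hp, Finsupp.add_apply]
  · intro g hg
    rw [Finset.mem_pi] at hg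
    rw [Finset.HasAntidiagonal.mem_antidiagonal]
    ext i
    rw [Finsupp.add_apply, Finsupp.indicator_apply, Finsupp.indicator_apply]
    split_ifs with h
    · exact Finset.HasAntidiagonal.mem_antidiagonal.mp (hg i h)
    · exact (Finsupp.notMem_support_iff.mp h).symm
  · intro p hp
    rw [Finset.HasAntidiagonal.mem_antidiagonal] at hp
    have : ∀ i ∉ d.support, p.1 i = 0 ∧ p.2 i = 0 := by
      intro i hi
      rw [Finsupp.notMem_support_iff, ← hp, Finsupp.add_apply] at hi
      omega
    apply Prod.ext <;> ext i <;> simp only [Finsupp.indicator_apply] <;> split_ifs with h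
    · rfl
    · exact (this i h).1.symm
    · rfl
    · exact (this i h).2.symm
  · intro g hg
    funext i hi
    simp only [Finsupp.indicator_apply]
    rw [dif_pos hi, dif_pos hi]
  · intro p hp
    exact (Finset.prod_attach d.support fun i => u (p.1 i) * v (p.2 i)).symm

theorem IsVarProd.mul {φ ψ : PowerSeries ℚ} {A B : PowerSeries SymFun}
    (hφ : PowerSeries.coeff 0 φ = 1) (hψ : PowerSeries.coeff 0 ψ = 1)
    (hA : IsVarProd φ A) (hB : IsVarProd ψ B) : IsVarProd (φ * ψ) (A * B) := by
  classical
  intro n d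
  rw [PowerSeries.coeff_mul, AddSubmonoidClass.coe_finsetSum, map_sum]
  simp only [Subalgebra.coe_mul, MvPowerSeries.coeff_mul, hA _ _, hB _ _, PowerSeries.coeff_mul]
  rw [Finset.sum_comm, ← sum_antidiagonal_prod (fun j => PowerSeries.coeff j φ)
    (fun j => PowerSeries.coeff j ψ) hφ hψ]
  have hite : ∀ (c : Prop) [Decidable c] (s : Finset ((ℕ →₀ ℕ) × (ℕ →₀ ℕ)))
      (f : (ℕ →₀ ℕ) × (ℕ →₀ ℕ) → ℚ), (if c then ∑ p ∈ s, f p else 0) =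
      ∑ p ∈ s, if c then f p else 0 := by
    intro c _ s f
    split_ifs <;> simp
  rw [hite]
  refine Finset.sum_congr rfl fun p hp => ?_
  have hdeg : p.1.degree + p.2.degree = d.degree := by
    rw [← Finset.HasAntidiagonal.mem_antidiagonal.mp hp, map_add]
  by_cases h : d.degree = n
  · rw [if_pos h, Finset.sum_eq_single (p.1.degree, p.2.degree)]
    · rw [if_pos rfl, if_pos rfl]
    · intro q _ hq
      by_cases h1 : p.1.degree = q.1
      · by_cases h2 : p.2.degree = q.2
        · exact absurd (Prod.ext h1.symm h2.symm) hq
        · rw [if_neg h2, mul_zero]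
      · rw [if_neg h1, zero_mul]
    · intro hn
      exact absurd (Finset.HasAntidiagonal.mem_antidiagonal.mpr (hdeg.trans h)) hn
  · rw [if_neg h, Finset.sum_eq_zero]
    intro q hq
    rw [Finset.HasAntidiagonal.mem_antidiagonal] at hq
    by_cases h1 : p.1.degree = q.1
    · rw [if_neg (c := p.2.degree = q.2) (by omega), mul_zero]
    · rw [if_neg h1, zero_mul]

theorem IsVarProd.one : IsVarProd 1 1 := by
  classical
  intro n d
  rw [PowerSeries.coeff_one]
  by_cases hd : d = 0
  · subst hd
    by_cases hn : n = 0
    · simp [hn]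
    · simp [hn, Ne.symm hn]
  · have h1 : (d.prod fun _ j => PowerSeries.coeff j (1 : PowerSeries ℚ)) = 0 := by
      obtain ⟨i, hi⟩ := Finsupp.support_nonempty_iff.mpr hd
      refine Finset.prod_eq_zero hi ?_
      exact (PowerSeries.coeff_one _).trans (if_neg (Finsupp.mem_support_iff.mp hi))
    rw [h1, ite_self]
    split_ifs
    · exact (MvPowerSeries.coeff_one _).trans (if_neg hd)
    · exact map_zero _

theorem IsVarProd.pow {φ : PowerSeries ℚ} {A : PowerSeries SymFun}
    (hφ : PowerSeries.coeff 0 φ = 1) (hA : IsVarProd φ A) (K : ℕ) : IsVarProd (φ ^ K) (A ^ K) := by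
  induction K with
  | zero => simpa using IsVarProd.one
  | succ K ih =>
    rw [pow_succ, pow_succ]
    refine IsVarProd.mul ?_ hφ ih hA
    rw [PowerSeries.coeff_zero_eq_constantCoeff_apply, map_pow,
      ← PowerSeries.coeff_zero_eq_constantCoeff_apply, hφ, one_pow]

theorem IsVarProd.unique {φ : PowerSeries ℚ} {A B : PowerSeries SymFun}
    (hA : IsVarProd φ A) (hB : IsVarProd φ B) : A = B := by
  ext n : 1
  apply Subtype.ext
  ext d
  rw [hA, hB]

theorem isVarProd_H : IsVarProd (PowerSeries.mk 1) H := by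
  intro n d
  rw [H, PowerSeries.coeff_mk, homSym, coeff_sumMonomials]
  simp [Finsupp.prod]

/-- `E(t) = ∑ e_n t^n`. -/
def E : PowerSeries SymFun := PowerSeries.mk elemSym

theorem isVarProd_E : IsVarProd (1 + PowerSeries.X) E := by
  intro n d
  rw [E, PowerSeries.coeff_mk, elemSym, coeff_sumMonomials]
  by_cases h : d.degree = n
  · rw [if_pos h]
    by_cases h1 : ∀ i, d i ≤ 1
    · rw [if_pos ⟨h, h1⟩, Finsupp.prod, Finset.prod_eq_one]
      intro i hi
      have h2 := h1 i
      rw [Finsupp.mem_support_iff] at hi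
      have h3 : d i = 1 := by omega
      rw [h3, map_add, PowerSeries.coeff_one_X, PowerSeries.coeff_one]
      simp
    · rw [if_neg fun h2 => h1 h2.2]
      push Not at h1
      obtain ⟨i, hi⟩ := h1
      symm
      refine Finset.prod_eq_zero (i := i) (Finsupp.mem_support_iff.mpr (by omega)) ?_
      change PowerSeries.coeff (d i) (1 + PowerSeries.X : PowerSeries ℚ) = 0
      rw [map_add, PowerSeries.coeff_X, PowerSeries.coeff_one, if_neg (by omega),
        if_neg (by omega), add_zero]
  · rw [if_neg h, if_neg fun h2 => h h2.1]

theorem IsVarProd.evalNeg {φ : PowerSeries ℚ} {A : PowerSeries SymFun}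
    (hA : IsVarProd φ A) : IsVarProd (PowerSeries.evalNegHom φ) (PowerSeries.evalNegHom A) := by
  intro n d
  rw [PowerSeries.evalNegHom, PowerSeries.evalNegHom, PowerSeries.coeff_rescale]
  have h1 : ((((-1 : SymFun) ^ n * PowerSeries.coeff n A : SymFun)) : MvPowerSeries ℕ ℚ) =
      (-1 : ℚ) ^ n • ((PowerSeries.coeff n A : SymFun) : MvPowerSeries ℕ ℚ) := by
    rcases neg_one_pow_eq_or ℚ n with h | h <;> rcases Nat.even_or_odd n with h' | h' <;>
      simp [h'.neg_one_pow]
  rw [h1, map_smul, hA, smul_eq_mul, mul_ite, mul_zero]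
  split_ifs with h
  · simp only [PowerSeries.coeff_rescale]
    rw [Finsupp.prod, Finsupp.prod, Finset.prod_mul_distrib, Finset.prod_pow_eq_pow_sum, ← h]
    rfl
  · rfl

theorem H_mul_E_neg : H * PowerSeries.evalNegHom E = 1 := by
  have h := IsVarProd.mul (by simp) (by simp [PowerSeries.evalNegHom]) isVarProd_H isVarProd_E.evalNeg
  have h2 : (PowerSeries.mk 1 : PowerSeries ℚ) * PowerSeries.evalNegHom (1 + PowerSeries.X) = 1 := by
    rw [map_add, map_one, PowerSeries.evalNegHom_X, ← sub_eq_add_neg,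
      PowerSeries.mk_one_mul_one_sub_eq_one]
  rw [h2] at h
  exact h.unique IsVarProd.one

theorem homSym_zero : homSym 0 = 1 := by
  apply Subtype.ext
  ext d
  change MvPowerSeries.coeff d (sumMonomials _) = MvPowerSeries.coeff d 1
  classical
  rw [coeff_sumMonomials, MvPowerSeries.coeff_one]
  simp [Finsupp.degree_eq_zero_iff]

theorem elemSym_zero : elemSym 0 = 1 := by
  apply Subtype.ext
  ext d
  change MvPowerSeries.coeff d (sumMonomials _) = MvPowerSeries.coeff d 1
  classical
  rw [coeff_sumMonomials, MvPowerSeries.coeff_one]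
  by_cases h : d = 0
  · subst h
    simp
  · rw [if_neg h, if_neg fun h2 => h ((Finsupp.degree_eq_zero_iff d).mp h2.1)]

theorem cast_eq_smul (q : ℚ) (x : SymFun) : algebraMap ℚ SymFun q * x = q • x :=
  (Algebra.smul_def q x).symm

theorem smul_countPerms {n : ℕ} (μ : n.Partition) (q : ℚ) (x : SymFun) :
    algebraMap ℚ SymFun q * ((μ.parts.countPerms : SymFun) * x) =
      (q * (len μ).factorial / ∏ i ∈ Finset.Icc 1 n, ((mult μ i).factorial : ℚ)) • x := by
  have h : (∏ i ∈ Finset.Icc 1 n, ((mult μ i).factorial : ℚ)) ≠ 0 :=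
    Finset.prod_ne_zero_iff.mpr fun i _ => Nat.cast_ne_zero.mpr (Nat.factorial_ne_zero _)
  rw [← countPerms_parts_mul, ← map_natCast (algebraMap ℚ SymFun), ← mul_assoc, ← map_mul,
    cast_eq_smul]
  push_cast
  rw [← mul_assoc, mul_div_cancel_right₀ _ h]

theorem hasSubst_of_coeff_zero {R : Type*} [CommRing R] {A : PowerSeries R}
    (hA : PowerSeries.coeff 0 A = 0) : PowerSeries.HasSubst A :=
  PowerSeries.HasSubst.of_constantCoeff_zero' (by simpa using hA)

theorem coeff_H_pow_hom (K n : ℕ) : PowerSeries.coeff n (H ^ K) =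
    ∑ μ : n.Partition, multinomialCoeff K n (mult μ) • homPart μ := by
  have hA : PowerSeries.coeff 0 (H - 1) = 0 := by
    rw [map_sub, H, PowerSeries.coeff_mk, homSym_zero]
    simp
  have hs := hasSubst_of_coeff_zero hA
  have h1 : H ^ K = ((1 + PowerSeries.X : PowerSeries SymFun) ^ K).subst (H - 1) := by
    rw [PowerSeries.subst_pow hs, PowerSeries.subst_add hs, PowerSeries.subst_X hs,
      ← PowerSeries.coe_substAlgHom hs, map_one]
    congr 1
    ring
  rw [h1, coeff_subst_eq_sum_partition _ hA]
  refine Finset.sum_congr rfl fun μ _ => ?_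
  have h2 : PowerSeries.coeff (len μ) ((1 + PowerSeries.X : PowerSeries SymFun) ^ K) =
      algebraMap ℚ SymFun (K.choose (len μ)) := by
    rw [← Polynomial.coe_one, ← Polynomial.coe_X, ← Polynomial.coe_add, ← Polynomial.coe_pow,
      Polynomial.coeff_coe, Polynomial.coeff_one_add_X_pow, map_natCast]
  have h3 : (μ.parts.map fun j => PowerSeries.coeff j (H - 1)).prod = homPart μ := by
    refine congrArg _ (Multiset.map_congr rfl fun j hj => ?_)
    rw [map_sub, PowerSeries.coeff_one, if_neg (μ.parts_pos hj).ne', sub_zero, H,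
      PowerSeries.coeff_mk]
  rw [h2, h3, smul_countPerms, multinomialCoeff, sum_mult, Nat.descFactorial_eq_factorial_mul_choose]
  push_cast
  rw [mul_comm (K.choose _ : ℚ)]

theorem sgn_eq {n : ℕ} (μ : n.Partition) : sgn μ = (μ.parts.map fun j => (-1 : ℚ) ^ (j + 1)).prod := by
  have h1 : ∀ s : Multiset ℕ, (s.map fun j => (-1 : ℚ) ^ (j + 1)).prod =
      (-1) ^ (s.sum + Multiset.card s) := by
    intro s
    induction s using Multiset.induction_on with
    | empty => simp
    | cons a s ih =>
      rw [Multiset.map_cons, Multiset.prod_cons, ih, ← pow_add, Multiset.sum_cons,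
        Multiset.card_cons]
      congr 1
      ring
  rw [h1, sgn, μ.parts_sum]
  have h2 := len_le μ
  have h3 : n + Multiset.card μ.parts = (n - len μ) + 2 * len μ := by
    change n + len μ = _
    omega
  rw [h3, pow_add, pow_mul]
  simp

theorem coeff_H_pow_elem {K : ℕ} (hK : 1 ≤ K) (n : ℕ) : PowerSeries.coeff n (H ^ K) =
    ∑ μ : n.Partition,
      (sgn μ * multinomialCoeff (K + len μ - 1) n (mult μ)) • elemPart μ := by
  obtain ⟨m, rfl⟩ : ∃ m, K = m + 1 := ⟨K - 1, by omega⟩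
  have hcoeff : ∀ j, PowerSeries.coeff j (PowerSeries.evalNegHom E) = (-1 : ℚ) ^ j • elemSym j := by
    intro j
    rw [PowerSeries.evalNegHom, PowerSeries.coeff_rescale, E, PowerSeries.coeff_mk,
      Algebra.smul_def, map_pow, map_neg, map_one]
  have hA : PowerSeries.coeff 0 (1 - PowerSeries.evalNegHom E) = 0 := by
    rw [map_sub, hcoeff, elemSym_zero]
    simp
  have hs := hasSubst_of_coeff_zero hA
  have h0 : (PowerSeries.mk 1 : PowerSeries SymFun).subst (1 - PowerSeries.evalNegHom E) = H := by
    have h := congrArg (PowerSeries.substAlgHom hs) (PowerSeries.mk_one_mul_one_sub_eq_one SymFun)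
    rw [map_mul, map_sub, map_one, PowerSeries.substAlgHom_X hs, PowerSeries.coe_substAlgHom hs,
      sub_sub_cancel] at h
    calc _ = _ * (H * PowerSeries.evalNegHom E) := by rw [H_mul_E_neg, mul_one]
      _ = H * (_ * PowerSeries.evalNegHom E) := by ring
      _ = H := by rw [h, mul_one]
  rw [← h0, ← PowerSeries.subst_pow hs, PowerSeries.mk_one_pow_eq_mk_choose_add,
    coeff_subst_eq_sum_partition _ hA]
  refine Finset.sum_congr rfl fun μ _ => ?_
  have h3 : (μ.parts.map fun j => PowerSeries.coeff j (1 - PowerSeries.evalNegHom E)).prod =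
      sgn μ • elemPart μ := by
    rw [sgn_eq, elemPart, Algebra.smul_def, map_multiset_prod, Multiset.map_map,
      ← Multiset.prod_map_mul]
    refine congrArg _ (Multiset.map_congr rfl fun j hj => ?_)
    rw [map_sub, PowerSeries.coeff_one, if_neg (μ.parts_pos hj).ne', zero_sub, hcoeff,
      Function.comp_apply, ← Algebra.smul_def, pow_succ, mul_neg_one, neg_smul]
  have h4 : m + 1 + len μ - 1 = m + len μ := by omega
  rw [PowerSeries.coeff_mk, h3, ← map_natCast (algebraMap ℚ SymFun), smul_countPerms, smul_smul, h4,
    multinomialCoeff, sum_mult, Nat.descFactorial_eq_factorial_mul_choose]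
  congr 1
  have h5 : (m + len μ).choose m = (m + len μ).choose (len μ) := Nat.choose_symm_add
  rw [h5]
  push_cast
  ring

theorem coeff_d_prod_eq_parts {n : ℕ} (μ : n.Partition) (u : ℕ → ℚ) (d : ℕ →₀ ℕ)
    (h : d.support.val.map d = μ.parts) : (d.prod fun _ j => u j) = (μ.parts.map u).prod := by
  rw [← h, Multiset.map_map]
  rfl

/-- The multiset of nonzero exponents of a monomial, as a partition. -/
def exponentPartition (d : ℕ →₀ ℕ) : d.degree.Partition where
  parts := d.support.val.map d
  parts_pos := by
    intro i hi
    obtain ⟨j, hj, rfl⟩ := Multiset.mem_map.mp hi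
    exact Nat.pos_of_ne_zero (Finsupp.mem_support_iff.mp hj)
  parts_sum := rfl

theorem IsVarProd.coeff_eq_sum_monomialSym {φ : PowerSeries ℚ} {A : PowerSeries SymFun}
    (hA : IsVarProd φ A) (n : ℕ) : PowerSeries.coeff n A = ∑ μ : n.Partition,
      (μ.parts.map fun j => PowerSeries.coeff j φ).prod • monomialSym μ := by
  classical
  apply Subtype.ext
  ext d
  rw [hA, AddSubmonoidClass.coe_finsetSum, map_sum]
  have h1 : ∀ μ : n.Partition, MvPowerSeries.coeff d (((μ.parts.map fun j =>
      PowerSeries.coeff j φ).prod • monomialSym μ : SymFun) : MvPowerSeries ℕ ℚ) =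
      if d.support.val.map d = μ.parts then d.prod fun _ j => PowerSeries.coeff j φ else 0 := by
    intro μ
    change MvPowerSeries.coeff d (_ • (sumMonomials _)) = _
    rw [map_smul, coeff_sumMonomials]
    simp only [Set.mem_ofPred_eq]
    split_ifs with h
    · rw [coeff_d_prod_eq_parts μ _ d h, smul_eq_mul, mul_one]
    · rw [smul_zero]
  rw [Finset.sum_congr rfl fun μ _ => h1 μ]
  by_cases h : d.degree = n
  · subst h
    rw [if_pos rfl, Finset.sum_eq_single (exponentPartition d)]
    · exact (if_pos rfl).symm
    · intro μ _ hμ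
      rw [if_neg]
      intro h
      exact hμ (Nat.Partition.ext h.symm)
    · intro h
      exact absurd (Finset.mem_univ _) h
  · rw [if_neg h, Finset.sum_eq_zero]
    intro μ _
    rw [if_neg]
    intro h2
    apply h
    rw [← μ.parts_sum, ← h2]
    rfl

theorem coeff_mk_one_pow {K : ℕ} (hK : 1 ≤ K) (j : ℕ) :
    PowerSeries.coeff j ((PowerSeries.mk 1 : PowerSeries ℚ) ^ K) = (j + K - 1).choose j := by
  obtain ⟨m, rfl⟩ : ∃ m, K = m + 1 := ⟨K - 1, by omega⟩
  rw [PowerSeries.mk_one_pow_eq_mk_choose_add, PowerSeries.coeff_mk, Nat.choose_symm_add]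
  congr 2
  omega

theorem coeff_H_pow_monomial {K : ℕ} (hK : 1 ≤ K) (n : ℕ) : PowerSeries.coeff n (H ^ K) =
    ∑ μ : n.Partition, ((μ.parts.map fun j => ((j + K - 1).choose j : ℚ)).prod) •
      monomialSym μ := by
  rw [(isVarProd_H.pow (by simp) K).coeff_eq_sum_monomialSym]
  simp only [coeff_mk_one_pow hK]

theorem coeff_E_pow_monomial (K : ℕ) (n : ℕ) : PowerSeries.coeff n (E ^ K) =
    ∑ μ : n.Partition, ((μ.parts.map fun j => (K.choose j : ℚ)).prod) • monomialSym μ := by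
  rw [(isVarProd_E.pow (by simp) K).coeff_eq_sum_monomialSym]
  have h2 : ∀ j, PowerSeries.coeff j ((1 + PowerSeries.X : PowerSeries ℚ) ^ K) = K.choose j := by
    intro j
    rw [← Polynomial.coe_one, ← Polynomial.coe_X, ← Polynomial.coe_add, ← Polynomial.coe_pow,
      Polynomial.coeff_coe, Polynomial.coeff_one_add_X_pow]
  simp only [h2]

theorem map_omega_E : PowerSeries.map (omega : SymFun →+* SymFun) E = H := by
  ext n : 1
  rw [PowerSeries.coeff_map, E, H, PowerSeries.coeff_mk, PowerSeries.coeff_mk]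
  rcases Nat.eq_zero_or_pos n with rfl | hn
  · rw [elemSym_zero, homSym_zero, map_one]
  · exact omega_elemSym hn

theorem map_evalNegHom (f : SymFun →+* SymFun) (A : PowerSeries SymFun) :
    PowerSeries.map f (PowerSeries.evalNegHom A) = PowerSeries.evalNegHom (PowerSeries.map f A) := by
  ext n : 1
  simp [PowerSeries.evalNegHom, PowerSeries.coeff_rescale]

theorem evalNegHom_evalNegHom (A : PowerSeries SymFun) :
    PowerSeries.evalNegHom (PowerSeries.evalNegHom A) = A := by
  ext n : 1
  rw [PowerSeries.evalNegHom, PowerSeries.coeff_rescale, PowerSeries.coeff_rescale, ← mul_assoc,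
    ← mul_pow]
  have h : (-1 : SymFun) * -1 = 1 := by ring
  exact (congrArg (fun z => z ^ n * PowerSeries.coeff n A) h).trans (by rw [one_pow, one_mul])

theorem map_omega_H : PowerSeries.map (omega : SymFun →+* SymFun) H = E := by
  have h1 := congrArg (PowerSeries.map (omega : SymFun →+* SymFun)) H_mul_E_neg
  rw [map_mul, map_evalNegHom, map_omega_E, map_one] at h1
  have h2 := congrArg PowerSeries.evalNegHom H_mul_E_neg
  rw [map_mul, evalNegHom_evalNegHom, map_one] at h2
  calc _ = PowerSeries.map (omega : SymFun →+* SymFun) H * (PowerSeries.evalNegHom H * E) := by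
        rw [h2, mul_one]
    _ = _ := by rw [← mul_assoc, h1, one_mul]

theorem omega_coeff_H_pow (K n : ℕ) :
    omega (PowerSeries.coeff n (H ^ K)) = PowerSeries.coeff n (E ^ K) := by
  rw [← map_omega_H, ← map_pow, PowerSeries.coeff_map]
  rfl

open PowerSeries in
/-- The solution of `t Y' = t P' Y` with `Y(0) = 1` is `exp P`. -/
theorem eq_exp_subst {R : Type*} [CommRing R] [Algebra ℚ R] [IsAddTorsionFree R]
    {P Y : PowerSeries R} (hP : coeff 0 P = 0) (hY : constantCoeff Y = 1)
    (h : X * derivative R Y = X * derivative R P * Y) : Y = (exp R).subst P := by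
  have hs := hasSubst_of_coeff_zero hP
  set G := (exp R).subst P with hG
  have hGd : derivative R G = G * derivative R P := by
    rw [hG, derivative_subst hs, derivative_exp]
  have hGc : constantCoeff G = 1 := by
    rw [← coeff_zero_eq_constantCoeff_apply, hG, coeff_subst_eq_sum_partition _ hP]
    have h0 : ∀ μ : Nat.Partition 0, μ.parts = 0 := fun μ =>
      Multiset.card_eq_zero.mp (Nat.le_zero.mp (len_le μ))
    rw [Fintype.sum_unique, len, h0]
    simp [Multiset.countPerms_zero]
  have h' : derivative R Y = derivative R P * Y := by
    have : X * derivative R Y = X * (derivative R P * Y) := by rw [h, mul_assoc]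
    ext n : 1
    have h2 := congrArg (coeff (n + 1)) this
    rwa [coeff_succ_X_mul, coeff_succ_X_mul] at h2
  obtain ⟨u, hu⟩ : IsUnit G := by
    rw [isUnit_iff_constantCoeff, hGc]
    exact isUnit_one
  have hZ : Y * (↑u⁻¹ : PowerSeries R) = 1 := by
    refine derivative.ext ?_ ?_
    · rw [Derivation.leibniz, derivative_inv, hu, hGd, h']
      have h3 : (↑u⁻¹ : PowerSeries R) * G = 1 := by rw [← hu, Units.inv_mul]
      simp only [smul_eq_mul, Derivation.map_one_eq_zero]
      linear_combination (-(Y * derivative R P * ↑u⁻¹)) * h3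
    · have h3 : (↑u⁻¹ : PowerSeries R) * G = 1 := by rw [← hu, Units.inv_mul]
      have h4 := congrArg constantCoeff h3
      rw [map_mul, hGc, mul_one] at h4
      rw [map_mul, hY, h4, one_mul]
  calc Y = Y * (↑u⁻¹ * G) := by rw [← hu, Units.inv_mul, mul_one]
    _ = G := by rw [← mul_assoc, hZ, one_mul]

theorem coeff_powSym_mul_homSym {i : ℕ} (hi : 1 ≤ i) (j : ℕ) (d : ℕ →₀ ℕ) :
    MvPowerSeries.coeff d ((powSym i * homSym j : SymFun) : MvPowerSeries ℕ ℚ) =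
      if d.degree = i + j then ((d.support.filter fun l => i ≤ d l).card : ℚ) else 0 := by
  classical
  rw [Subalgebra.coe_mul, MvPowerSeries.coeff_mul]
  simp only [powSym, homSym, coeff_sumMonomials, Set.mem_ofPred_eq, ite_mul, one_mul, zero_mul]
  split_ifs with h
  · refine (Finset.sum_congr rfl fun p hp => (?_ : _ = if ∃ l, p.1 = Finsupp.single l i
      then (1 : ℚ) else 0)).trans ?_
    · split_ifs with h2 h3
      · rfl
      · obtain ⟨l, hl⟩ := h2
        have h4 := congrArg Finsupp.degree (Finset.HasAntidiagonal.mem_antidiagonal.mp hp)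
        rw [map_add, hl, Finsupp.degree_single] at h4
        omega
      · rfl
    rw [Finset.sum_boole]
    congr 1
    symm
    refine Finset.card_bij (fun l _ => (Finsupp.single l i, d - Finsupp.single l i)) ?_ ?_ ?_
    · intro l hl
      rw [Finset.mem_filter] at hl ⊢
      refine ⟨Finset.HasAntidiagonal.mem_antidiagonal.mpr (add_tsub_cancel_of_le ?_), l, rfl⟩
      rw [Finsupp.single_le_iff]
      exact hl.2
    · intro l _ l' _ hll
      exact Finsupp.single_left_injective (by omega) (congrArg Prod.fst hll)
    · intro p hp
      rw [Finset.mem_filter, Finset.HasAntidiagonal.mem_antidiagonal] at hp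
      obtain ⟨hp, l, hl⟩ := hp
      have h2 : i ≤ d l := by
        rw [← hp, hl]
        simp
      refine ⟨l, ?_, ?_⟩
      · rw [Finset.mem_filter, Finsupp.mem_support_iff]
        omega
      · apply Prod.ext
        · exact hl.symm
        · rw [← hl, ← hp]
          simp
  · refine Finset.sum_eq_zero fun p hp => ?_
    split_ifs with h2 h3
    · obtain ⟨l, hl⟩ := h2
      have h4 := congrArg Finsupp.degree (Finset.HasAntidiagonal.mem_antidiagonal.mp hp)
      rw [map_add, hl, Finsupp.degree_single] at h4
      omega
    · rfl
    · rfl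

/-- Newton's identity `n h_n = ∑ p_i h_{n-i}`. -/
theorem newton (n : ℕ) : (n : ℚ) • homSym n = ∑ p ∈ Finset.HasAntidiagonal.antidiagonal n,
    if p.1 = 0 then 0 else powSym p.1 * homSym p.2 := by
  classical
  apply Subtype.ext
  ext d
  rw [AddSubmonoidClass.coe_finsetSum, map_sum]
  have h1 : ∀ p ∈ Finset.HasAntidiagonal.antidiagonal n,
      MvPowerSeries.coeff d ((if p.1 = 0 then 0 else powSym p.1 * homSym p.2 : SymFun) :
        MvPowerSeries ℕ ℚ) = if d.degree = n then
        (if p.1 = 0 then 0 else ((d.support.filter fun l => p.1 ≤ d l).card : ℚ)) else 0 := by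
    intro p hp
    rw [Finset.HasAntidiagonal.mem_antidiagonal] at hp
    by_cases h : p.1 = 0
    · rw [if_pos h, if_pos h, ite_self]
      exact map_zero _
    · rw [if_neg h, if_neg h, coeff_powSym_mul_homSym (by omega), hp]
  rw [Finset.sum_congr rfl h1]
  have h2 : MvPowerSeries.coeff d (((n : ℚ) • homSym n : SymFun) : MvPowerSeries ℕ ℚ) =
      if d.degree = n then (n : ℚ) else 0 := by
    change MvPowerSeries.coeff d ((n : ℚ) • sumMonomials _) = _
    rw [map_smul, coeff_sumMonomials]
    simp
  rw [h2]
  split_ifs with h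
  · rw [Finset.Nat.sum_antidiagonal_eq_sum_range_succ_mk, Finset.sum_range_succ']
    simp only [Nat.add_eq_zero_iff, one_ne_zero, and_false, if_false, if_true, add_zero]
    simp only [← Finset.sum_boole]
    rw [Finset.sum_comm]
    simp only [Finset.sum_boole]
    have h3 : ∀ l ∈ d.support, ((Finset.range n).filter fun i => i + 1 ≤ d l).card = d l := by
      intro l hl
      have h4 : d l ≤ n := h ▸ Finsupp.le_degree l d
      have h5 : ((Finset.range n).filter fun i => i + 1 ≤ d l) = Finset.range (d l) := by
        ext i
        rw [Finset.mem_filter, Finset.mem_range, Finset.mem_range]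
        omega
      rw [h5, Finset.card_range]
    rw [Finset.sum_congr rfl fun l hl => congrArg (Nat.cast (R := ℚ)) (h3 l hl), ← h]
    rw [← Nat.cast_sum]
    rfl
  · simp

/-- `P(t) = ∑ p_n t^n / n`. -/
def logH : PowerSeries SymFun := PowerSeries.mk fun n => if n = 0 then 0 else (n : ℚ)⁻¹ • powSym n

theorem H_eq_exp : H = (PowerSeries.exp SymFun).subst logH := by
  have : IsAddTorsionFree SymFun := IsAddTorsionFree.of_module_rat _
  refine eq_exp_subst (by simp [logH]) ?_ ?_
  · rw [← PowerSeries.coeff_zero_eq_constantCoeff_apply, H, PowerSeries.coeff_mk, homSym_zero]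
  · have hX : ∀ (A : PowerSeries SymFun) (n : ℕ),
        PowerSeries.coeff n (PowerSeries.X * PowerSeries.derivative SymFun A) =
          (n : ℚ) • PowerSeries.coeff n A := by
      intro A n
      rw [Algebra.smul_def, map_natCast]
      cases n with
      | zero => simp
      | succ n =>
        rw [PowerSeries.coeff_succ_X_mul, PowerSeries.coeff_derivative, mul_comm]
        push_cast
        ring
    ext n : 1
    rw [hX, H, PowerSeries.coeff_mk, newton, PowerSeries.coeff_mul]
    refine Finset.sum_congr rfl fun p _ => ?_
    rw [hX, PowerSeries.coeff_mk, logH, PowerSeries.coeff_mk]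
    split_ifs with h
    · simp
    · rw [smul_smul, mul_inv_cancel₀ (Nat.cast_ne_zero.mpr h), one_smul]

theorem zee_eq {n : ℕ} (μ : n.Partition) : zee μ = (μ.parts.map fun j : ℕ => (j : ℚ)).prod *
    ∏ i ∈ Finset.Icc 1 n, ((mult μ i).factorial : ℚ) := by
  rw [prod_map_parts, zee, Finset.prod_mul_distrib]

theorem coeff_H_pow_power (K n : ℕ) : PowerSeries.coeff n (H ^ K) =
    ∑ μ : n.Partition, ((zee μ)⁻¹ * (K : ℚ) ^ len μ) • powPart μ := by
  have hA : PowerSeries.coeff 0 logH = 0 := by simp [logH]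
  rw [H_eq_exp, ← PowerSeries.subst_pow (hasSubst_of_coeff_zero hA),
    PowerSeries.exp_pow_eq_rescale_exp, coeff_subst_eq_sum_partition _ hA]
  refine Finset.sum_congr rfl fun μ _ => ?_
  have h3 : (μ.parts.map fun j => PowerSeries.coeff j logH).prod =
      ((μ.parts.map fun j : ℕ => (j : ℚ)).prod)⁻¹ • powPart μ := by
    rw [powPart, Algebra.smul_def, ← Multiset.prod_map_inv', Multiset.map_map, map_multiset_prod,
      Multiset.map_map, ← Multiset.prod_map_mul]
    refine congrArg _ (Multiset.map_congr rfl fun j hj => ?_)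
    rw [logH, PowerSeries.coeff_mk, if_neg (μ.parts_pos hj).ne', Algebra.smul_def]
    rfl
  have h4 : PowerSeries.coeff (len μ) (PowerSeries.rescale (K : SymFun) (PowerSeries.exp SymFun)) =
      algebraMap ℚ SymFun ((K : ℚ) ^ len μ * (1 / (len μ).factorial)) := by
    rw [PowerSeries.coeff_rescale, PowerSeries.coeff_exp, map_mul, map_pow, map_natCast]
  have h5 : ((len μ).factorial : ℚ) ≠ 0 := Nat.cast_ne_zero.mpr (Nat.factorial_ne_zero _)
  rw [h3, h4, smul_countPerms, smul_smul, zee_eq]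
  congr 1
  rw [mul_inv]
  field_simp

/-- The cycle lemma: a walk with steps at least `-1` that descends by `k` in each period has
exactly `k` starting points in a period from which it stays above the final level. -/
theorem card_cycle_lemma (S : ℕ → ℤ) {M : ℕ} (hM : 0 < M) (k : ℕ) (hk : 0 < k)
    (hper : ∀ m, S (m + M) = S m - k) (hstep : ∀ m, S m - 1 ≤ S (m + 1)) :
    ((Finset.range M).filter fun s => ∀ p < M, S s - k < S (s + p)).card = k := by
  have hne : (Finset.range M).Nonempty := ⟨0, Finset.mem_range.mpr hM⟩
  set m : ℕ → ℤ := fun t => (Finset.range M).inf' hne fun j => S (t + j) with hm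
  have hle : ∀ t, ∀ j < M, m t ≤ S (t + j) := fun t j hj =>
    Finset.inf'_le (fun j => S (t + j)) (Finset.mem_range.mpr hj)
  have hex : ∀ t, ∃ j < M, m t = S (t + j) := fun t => by
    obtain ⟨j, hj, h⟩ := Finset.exists_mem_eq_inf' hne fun j => S (t + j)
    exact ⟨j, Finset.mem_range.mp hj, h⟩
  have hle' : ∀ t, ∀ j, 1 ≤ j → j ≤ M → m (t + 1) ≤ S (t + j) := by
    intro t j h1 h2
    have := hle (t + 1) (j - 1) (by omega)
    rwa [show t + 1 + (j - 1) = t + j by omega] at this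
  have hex' : ∀ t, ∃ j, 1 ≤ j ∧ j ≤ M ∧ m (t + 1) = S (t + j) := by
    intro t
    obtain ⟨j, hj, h⟩ := hex (t + 1)
    exact ⟨j + 1, by omega, by omega, by rw [h]; congr 1; omega⟩
  have hdec : ∀ t, m t - m (t + 1) = if ∀ p < M, S t - k < S (t + p) then 1 else 0 := by
    intro t
    have h1 : m (t + 1) ≤ m t := by
      obtain ⟨j, hj, h⟩ := hex t
      rcases Nat.eq_zero_or_pos j with rfl | hj0
      · have h2 := hle' t M hM le_rfl
        rw [hper] at h2
        rw [add_zero] at h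
        omega
      · rw [h]
        exact hle' t j hj0 hj.le
    obtain ⟨j', hj1, hj2, h'⟩ := hex' t
    split_ifs with hg
    · obtain ⟨j, hj, h⟩ := hex t
      have h2 := hg j hj
      have h3 := hle t (M - 1) (by omega)
      have h4 := hstep (t + (M - 1))
      rw [show t + (M - 1) + 1 = t + M by omega, hper] at h4
      have h5 := hle' t M hM le_rfl
      rw [hper] at h5
      rcases Nat.lt_or_ge j' M with h6 | h6
      · have h7 := hg j' h6
        omega
      · obtain rfl : j' = M := by omega
        rw [hper] at h'
        omega
    · push Not at hg
      obtain ⟨p, hp, hpp⟩ := hg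
      have h2 := hle t p hp
      rcases Nat.lt_or_ge j' M with h6 | h6
      · have h7 := hle t j' h6
        omega
      · obtain rfl : j' = M := by omega
        rw [hper] at h'
        omega
  have hmM : m (0 + M) = m 0 - k := by
    obtain ⟨j, hj, h⟩ := hex 0
    obtain ⟨j', hj', h'⟩ := hex (0 + M)
    have h1 := hle 0 j' hj'
    have h2 := hle (0 + M) j hj
    rw [show 0 + M + j = (0 + j) + M by omega, hper] at h2
    rw [show 0 + M + j' = (0 + j') + M by omega, hper] at h'
    omega
  have hsum := Finset.sum_range_sub' m M
  rw [Finset.sum_congr rfl fun t _ => hdec t, Finset.sum_boole] at hsum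
  rw [zero_add] at hmM
  omega

/-- The condition on `a i - 1`, with values taken modulo `M = r n + k`, that makes `a` a parking
function. -/
def Parks (r k : ℕ) {n M : ℕ} (a : Fin n → ZMod M) : Prop :=
  ∀ p < M, p < k + r * (Finset.univ.filter fun i => (a i).val < p).card

theorem card_filter_val_sub_lt {n M : ℕ} [NeZero M] (a : Fin n → ZMod M) (s : ℕ) :
    ∀ p ≤ M, (Finset.univ.filter fun i => (a i - (s : ZMod M)).val < p).card =
      ∑ j ∈ Finset.range p, (Finset.univ.filter fun i => a i = ((s + j : ℕ) : ZMod M)).card := by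
  intro p
  induction p with
  | zero => simp
  | succ p ih =>
    intro hp
    rw [Finset.sum_range_succ, ← ih (by omega), ← Finset.card_union_of_disjoint]
    · congr 1
      ext i
      simp only [Finset.mem_filter, Finset.mem_union, Finset.mem_univ, true_and]
      have h1 : a i = ((s + p : ℕ) : ZMod M) ↔ (a i - (s : ZMod M)).val = p := by
        rw [Nat.cast_add, ← sub_eq_iff_eq_add']
        constructor
        · intro h
          rw [h, ZMod.val_natCast, Nat.mod_eq_of_lt hp]
        · intro h
          rw [← h, ZMod.natCast_val, ZMod.cast_id']
          rfl
      rw [h1]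
      omega
    · rw [Finset.disjoint_filter]
      intro i _ h1 h2
      rw [h2, Nat.cast_add, add_sub_cancel_left, ZMod.val_natCast, Nat.mod_eq_of_lt hp] at h1
      omega

open Classical in
/-- Pollak's argument: each translation class contains exactly `k` parking functions. -/
theorem card_parks_sub {r k n M : ℕ} (hM : M = r * n + k) (hk : 1 ≤ k)
    (a : Fin n → ZMod M) :
    ((Finset.range M).filter fun s : ℕ => Parks r k fun i => a i - (s : ZMod M)).card = k := by
  have : NeZero M := ⟨by omega⟩
  set c : ℕ → ℕ := fun j => (Finset.univ.filter fun i => a i = (j : ZMod M)).card with hc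
  set S : ℕ → ℤ := fun m => ∑ j ∈ Finset.range m, ((r : ℤ) * c j - 1) with hS
  have hdiff : ∀ s, ∀ p ≤ M, S (s + p) = S s +
      r * ((Finset.univ.filter fun i => (a i - (s : ZMod M)).val < p).card : ℤ) - p := by
    intro s p hp
    rw [card_filter_val_sub_lt a s p hp, hS]
    simp only
    rw [Finset.sum_range_add, Finset.sum_sub_distrib _ _ (s := Finset.range p), ← Finset.mul_sum]
    simp [hc]
    ring
  have hper : ∀ m, S (m + M) = S m - k := by
    intro m
    rw [hdiff m M le_rfl, Finset.filter_true_of_mem fun i _ => ZMod.val_lt _, Finset.card_univ,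
      Fintype.card_fin, hM]
    push_cast
    ring
  have hstep : ∀ m, S m - 1 ≤ S (m + 1) := by
    intro m
    rw [hS]
    simp only [Finset.sum_range_succ]
    have : (0 : ℤ) ≤ r * c m := by positivity
    omega
  refine Eq.trans ?_ (card_cycle_lemma S (by omega) k hk hper hstep)
  congr 1
  refine Finset.filter_congr fun s _ => forall_congr' fun p => imp_congr_right fun hp => ?_
  rw [hdiff s p hp.le]
  zify
  constructor <;> intro h <;> linarith

theorem mem_PF_iff {r k n : ℕ} (a : Fin n → ℕ) : a ∈ PF r k n ↔ (∀ i, 1 ≤ a i) ∧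
    (∀ i, a i ≤ r * n + k) ∧
    ∀ p < r * n + k, p < k + r * (Finset.univ.filter fun i => a i - 1 < p).card := by
  set g := a ∘ Tuple.sort a with hg
  have hmono : Monotone g := Tuple.monotone_sort a
  have hcard : ∀ p, (Finset.univ.filter fun i => a i - 1 < p).card =
      (Finset.univ.filter fun i => g i - 1 < p).card := by
    intro p
    symm
    refine Finset.card_bij (fun i _ => Tuple.sort a i) ?_ ?_ ?_
    · intro i hi
      simpa [hg] using hi
    · intro i _ j _ h
      exact (Tuple.sort a).injective h
    · intro i hi
      exact ⟨(Tuple.sort a).symm i, by simpa [hg] using hi, by simp⟩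
  constructor
  · rintro ⟨h1, h2⟩
    have h1' : ∀ i, 1 ≤ g i := fun i => h1 _
    refine ⟨h1, fun i => ?_, fun p hp => ?_⟩
    · have h3 := h2 ((Tuple.sort a).symm i)
      rw [Function.comp_apply, Equiv.apply_symm_apply] at h3
      have h4 : ((Tuple.sort a).symm i : ℕ) * r ≤ r * n := by
        rw [mul_comm]
        exact Nat.mul_le_mul_left r (Fin.is_lt _).le
      omega
    · rw [hcard]
      set m := (Finset.univ.filter fun i => g i - 1 < p).card with hm
      have hmn : m ≤ n := (Finset.card_le_univ _).trans_eq (Fintype.card_fin n)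
      rcases hmn.lt_or_eq with h | h
      · have h3 : p < g ⟨m, h⟩ := by
          by_contra h4
          have h5 : Finset.univ.filter (fun i : Fin n => i ≤ ⟨m, h⟩) ⊆
              Finset.univ.filter fun i => g i - 1 < p := by
            intro i hi
            rw [Finset.mem_filter] at hi ⊢
            refine ⟨hi.1, ?_⟩
            have := hmono hi.2
            have := h1' i
            omega
          have h6 := Finset.card_le_card h5
          have h7 : (Finset.univ.filter (fun i : Fin n => i ≤ ⟨m, h⟩)).card = m + 1 :=
            Fin.card_Iic (⟨m, h⟩ : Fin n) |> fun h8 => by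
              rw [← h8]
              congr 1
              ext i
              simp
          omega
        have h4 := h2 ⟨m, h⟩
        rw [mul_comm] at h4
        exact lt_of_lt_of_le h3 h4
      · rw [h]
        omega
  · rintro ⟨h1, h2, h3⟩
    refine ⟨h1, fun i => ?_⟩
    have h4 := h1 (Tuple.sort a i)
    have h5 := h2 (Tuple.sort a i)
    change 1 ≤ g i at h4
    change g i ≤ _ at h5
    have h6 := h3 (g i - 1) (by omega)
    rw [hcard] at h6
    have h7 : (Finset.univ.filter fun j => g j - 1 < g i - 1).card ≤ i := by
      rw [← Fin.card_Iio i]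
      refine Finset.card_le_card fun j hj => ?_
      rw [Finset.mem_filter] at hj
      rw [Finset.mem_Iio]
      by_contra h8
      have := hmono (not_lt.mp h8)
      omega
    have h8 := Nat.mul_le_mul_left r h7
    change g i ≤ _
    rw [mul_comm]
    omega

open Equiv.Perm in
theorem card_invariant_functions {α : Type*} [Fintype α] [DecidableEq α] (β : Type*)
    (w : Equiv.Perm α) : Nat.card {a : α → β // ∀ i, a (w i) = a i} =
      Nat.card β ^ len w.partition := by
  have hlen : len w.partition = Nat.card (w.cycleFactorsFinset ⊕ {x // x ∉ w.support}) := by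
    rw [Nat.card_sum, Nat.card_eq_fintype_card, Nat.card_eq_fintype_card, Fintype.card_coe, len,
      parts_partition, Multiset.card_add, Multiset.card_replicate, cycleType_def, Multiset.card_map,
      ← Finset.card_compl, Fintype.card_subtype]
    congr 2
    ext x
    simp
  have hinv : ∀ (a : α → β), (∀ i, a (w i) = a i) → ∀ x y, w.SameCycle x y → a x = a y := by
    rintro a ha x y ⟨j, rfl⟩
    induction j using Int.induction_on with
    | zero => rfl
    | succ j ih => rw [ih, add_comm, zpow_add, zpow_one, mul_apply, ha]
    | pred j ih =>
      rw [ih, ← ha ((w ^ (-(j : ℤ) - 1)) x), ← mul_apply, ← zpow_one_add]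
      congr 3
      ring
  have hrep : ∀ c : w.cycleFactorsFinset, ∃ x, x ∈ c.1.support := fun c =>
    (mem_cycleFactorsFinset_iff.mp c.2).1.nonempty_support
  choose rep hr using hrep
  have hrep' : ∀ c : w.cycleFactorsFinset, rep c ∈ w.support := fun c =>
    mem_cycleFactorsFinset_support_le c.2 (hr c)
  have hcyc : ∀ c : w.cycleFactorsFinset, w.cycleOf (rep c) = c.1 := fun c =>
    (cycle_is_cycleOf (hr c) c.2).symm
  let g : α → w.cycleFactorsFinset ⊕ {x // x ∉ w.support} := fun x =>
    if h : x ∈ w.support then Sum.inl ⟨w.cycleOf x, cycleOf_mem_cycleFactorsFinset_iff.mpr h⟩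
    else Sum.inr ⟨x, h⟩
  have hg : ∀ i, g (w i) = g i := by
    intro i
    by_cases h : i ∈ w.support
    · have h' : w i ∈ w.support := apply_mem_support.mpr h
      simp only [g, dif_pos h, dif_pos h']
      exact congrArg Sum.inl (Subtype.ext (SameCycle.cycleOf_eq ⟨1, by simp⟩).symm)
    · rw [notMem_support.mp h]
  let e : {a : α → β // ∀ i, a (w i) = a i} ≃ (w.cycleFactorsFinset ⊕ {x // x ∉ w.support} → β) :=
    { toFun := fun a => Sum.elim (fun c => a.1 (rep c)) (fun x => a.1 x)
      invFun := fun b => ⟨fun x => b (g x), fun i => congrArg b (hg i)⟩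
      left_inv := by
        intro a
        apply Subtype.ext
        funext x
        by_cases h : x ∈ w.support
        · simp only [g, dif_pos h, Sum.elim_inl]
          refine hinv a.1 a.2 _ _ ?_
          rw [sameCycle_iff_cycleOf_eq_of_mem_support (hrep' _) h, hcyc]
        · simp only [g, dif_neg h, Sum.elim_inr]
      right_inv := by
        intro b
        funext q
        rcases q with c | x
        · simp only [Sum.elim_inl, g, dif_pos (hrep' c)]
          congr 2
          exact Subtype.ext (hcyc c)
        · simp only [Sum.elim_inr, g, dif_neg x.2] }
  rw [Nat.card_congr e, Nat.card_fun, hlen]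

open Classical in
theorem card_fixedBy_PF {r k n M : ℕ} (hM : M = r * n + k) (hk : 1 ≤ k)
    (w : Equiv.Perm (Fin n)) :
    Nat.card (MulAction.fixedBy (PF r k n) w) * M = k * M ^ len w.partition := by
  have : NeZero M := ⟨by omega⟩
  have hfix : ∀ x : PF r k n, x ∈ MulAction.fixedBy (PF r k n) w ↔ ∀ i, x.1 (w i) = x.1 i := by
    intro x
    rw [MulAction.mem_fixedBy]
    constructor
    · intro h i
      have h2 : x.1 (w⁻¹ (w i)) = x.1 (w i) := congrFun (congrArg Subtype.val h) (w i)
      rw [← h2]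
      exact congrArg x.1 (w.symm_apply_apply i)
    · intro h
      apply Subtype.ext
      funext i
      change x.1 (w⁻¹ i) = x.1 i
      rw [← h (w⁻¹ i)]
      exact congrArg x.1 (w.apply_symm_apply i)
  let e : MulAction.fixedBy (PF r k n) w ≃
      {a : Fin n → ZMod M // (∀ i, a (w i) = a i) ∧ Parks r k a} :=
    { toFun := fun x => ⟨fun i => ((x.1.1 i - 1 : ℕ) : ZMod M), by
        obtain ⟨h1, h2, h3⟩ := (mem_PF_iff _).mp x.1.2
        refine ⟨fun i => by simp only [(hfix x.1).mp x.2 i], fun p hp => ?_⟩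
        rw [hM] at hp
        have h4 := h3 p hp
        have h5 : ∀ i, (((x.1.1 i - 1 : ℕ) : ZMod M)).val = x.1.1 i - 1 := by
          intro i
          have := h1 i
          have := h2 i
          rw [ZMod.val_natCast, Nat.mod_eq_of_lt (by omega)]
        simpa only [h5] using h4⟩
      invFun := fun a => ⟨⟨fun i => (a.1 i).val + 1, (mem_PF_iff _).mpr ⟨fun i => by omega, fun i => by
          have := ZMod.val_lt (a.1 i)
          omega, fun p hp => by
          simpa only [Nat.add_sub_cancel] using a.2.2 p (by omega)⟩⟩,
        (hfix _).mpr fun i => by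
          change (a.1 (w i)).val + 1 = (a.1 i).val + 1
          rw [a.2.1 i]⟩
      left_inv := by
        intro x
        obtain ⟨h1, h2, h3⟩ := (mem_PF_iff _).mp x.1.2
        apply Subtype.ext
        apply Subtype.ext
        funext i
        have h4 := h1 i
        have h5 := h2 i
        change (((x.1.1 i - 1 : ℕ) : ZMod M)).val + 1 = x.1.1 i
        rw [ZMod.val_natCast, Nat.mod_eq_of_lt (by omega)]
        omega
      right_inv := by
        intro a
        apply Subtype.ext
        funext i
        change (((a.1 i).val + 1 - 1 : ℕ) : ZMod M) = a.1 i
        rw [Nat.add_sub_cancel, ZMod.natCast_val, ZMod.cast_id']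
        rfl }
  rw [Nat.card_congr e, Nat.card_eq_fintype_card, Fintype.card_subtype]
  set X : Finset (Fin n → ZMod M) := Finset.univ.filter fun a => ∀ i, a (w i) = a i with hX
  have hXcard : X.card = M ^ len w.partition := by
    have h := card_invariant_functions (ZMod M) w
    rw [Nat.card_zmod, Nat.card_eq_fintype_card, Fintype.card_subtype] at h
    exact h
  have hdc := Finset.sum_card_bipartiteAbove_eq_sum_card_bipartiteBelow (s := X)
    (t := Finset.range M) fun (a : Fin n → ZMod M) (s : ℕ) => Parks r k fun i => a i - (s : ZMod M)
  have h1 : ∀ a ∈ X, (Finset.bipartiteAbove (fun (a : Fin n → ZMod M) (s : ℕ) =>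
      Parks r k fun i => a i - (s : ZMod M)) (Finset.range M) a).card = k :=
    fun a _ => card_parks_sub hM hk a
  have h2 : ∀ s ∈ Finset.range M, (Finset.bipartiteBelow (fun (a : Fin n → ZMod M) (s : ℕ) =>
      Parks r k fun i => a i - (s : ZMod M)) X s).card = (X.filter fun a => Parks r k a).card := by
    intro s _
    refine Finset.card_bij' (fun a _ i => a i - (s : ZMod M)) (fun a _ i => a i + (s : ZMod M))
      ?_ ?_ ?_ ?_
    · intro a ha
      rw [Finset.mem_bipartiteBelow, hX, Finset.mem_filter] at ha
      rw [Finset.mem_filter, hX, Finset.mem_filter]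
      exact ⟨⟨Finset.mem_univ _, fun i => by simp only [ha.1.2 i]⟩, ha.2⟩
    · intro a ha
      rw [Finset.mem_filter, hX, Finset.mem_filter] at ha
      rw [Finset.mem_bipartiteBelow, hX, Finset.mem_filter]
      exact ⟨⟨Finset.mem_univ _, fun i => by simp only [ha.1.2 i]⟩, by simpa using ha.2⟩
    · intro a _
      simp
    · intro a _
      simp
  rw [Finset.sum_congr rfl h1, Finset.sum_congr rfl h2, Finset.sum_const, Finset.sum_const,
    hXcard, Finset.card_range, hX, Finset.filter_filter, smul_eq_mul, smul_eq_mul] at hdc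
  rw [mul_comm k, hdc, mul_comm]

theorem prod_mult_factorial {n : ℕ} (μ : n.Partition) (s : Finset ℕ) (hs : μ.parts.toFinset ⊆ s) :
    ∏ i ∈ s, (mult μ i).factorial = ∏ i ∈ μ.parts.toFinset, (mult μ i).factorial := by
  symm
  refine Finset.prod_subset hs fun i _ hi => ?_
  rw [Multiset.mem_toFinset] at hi
  rw [mult, Multiset.count_eq_zero_of_notMem hi, Nat.factorial_zero]

open Equiv.Perm in
/-- The size of a conjugacy class of a symmetric group. -/
theorem card_partition_eq_mul_zee {α : Type*} [Fintype α] [DecidableEq α]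
    (μ : (Fintype.card α).Partition) :
    ((Finset.univ.filter fun w : Equiv.Perm α => w.partition = μ).card : ℚ) * zee μ =
      (Fintype.card α).factorial := by
  set m := μ.parts.filter fun i => 2 ≤ i with hm
  have hsplit : μ.parts = m + Multiset.replicate (mult μ 1) 1 := by
    have h1 : μ.parts.filter (fun i => ¬ 2 ≤ i) = Multiset.replicate (mult μ 1) 1 := by
      rw [mult, ← Multiset.filter_eq']
      refine Multiset.filter_congr fun i hi => ?_
      have := μ.parts_pos hi
      omega
    rw [hm, ← h1, Multiset.filter_add_not]
  have hsum : m.sum + mult μ 1 = Fintype.card α := by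
    have h := congrArg Multiset.sum hsplit
    rw [Multiset.sum_add, Multiset.sum_replicate, μ.parts_sum, smul_eq_mul, mul_one] at h
    exact h.symm
  have hiff : ∀ w : Equiv.Perm α, w.partition = μ ↔ w.cycleType = m := by
    intro w
    constructor
    · rintro rfl
      rw [hm, filter_parts_partition_eq_cycleType]
    · intro h
      apply Nat.Partition.ext
      rw [parts_partition, hsplit, ← sum_cycleType, h]
      congr 2
      omega
  have hfilter : (Finset.univ.filter fun w : Equiv.Perm α => w.partition = μ) =
      Finset.univ.filter fun w : Equiv.Perm α => w.cycleType = m :=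
    Finset.filter_congr fun w _ => hiff w
  have hcard := card_of_cycleType_mul_eq α m
  rw [if_pos ⟨by omega, fun a ha => (Multiset.mem_filter.mp ha).2⟩] at hcard
  rw [hfilter, ← hcard, Nat.cast_mul]
  congr 1
  have h1 : Fintype.card α - m.sum = mult μ 1 := by omega
  have hparts : (μ.parts.map fun j : ℕ => (j : ℚ)).prod = (m.prod : ℚ) := by
    rw [hsplit, Multiset.map_add, Multiset.prod_add, Multiset.map_replicate,
      Multiset.prod_replicate, Nat.cast_one, one_pow, mul_one]
    exact (map_multiset_prod (Nat.castRingHom ℚ) m).symm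
  have h1m : 1 ∉ m.toFinset := by
    rw [Multiset.mem_toFinset, hm, Multiset.mem_filter]
    omega
  have hfact : ∏ i ∈ Finset.Icc 1 (Fintype.card α), (mult μ i).factorial =
      (mult μ 1).factorial * ∏ i ∈ m.toFinset, (m.count i).factorial := by
    rw [prod_mult_factorial μ _ fun i hi => ?_, ← prod_mult_factorial μ (insert 1 m.toFinset)
      fun i hi => ?_, Finset.prod_insert h1m]
    · congr 1
      refine Finset.prod_congr rfl fun i hi => ?_
      rw [mult, hm, Multiset.count_filter_of_pos]
      rw [Multiset.mem_toFinset, hm, Multiset.mem_filter] at hi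
      exact hi.2
    · rw [Multiset.mem_toFinset] at hi
      rw [Finset.mem_insert, Multiset.mem_toFinset, hm, Multiset.mem_filter]
      have := μ.parts_pos hi
      by_cases h : i = 1
      · exact Or.inl h
      · exact Or.inr ⟨hi, by omega⟩
    · rw [Multiset.mem_toFinset] at hi
      exact Finset.mem_Icc.mpr ⟨μ.parts_pos hi, μ.le_of_mem_parts hi⟩
  rw [zee_eq, hparts, h1]
  have h2 := congrArg (Nat.cast (R := ℚ)) hfact
  rw [Nat.cast_prod, Nat.cast_mul] at h2
  rw [h2, Nat.cast_mul, Nat.cast_mul]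
  ring

theorem zee_ne_zero {n : ℕ} (μ : n.Partition) : zee μ ≠ 0 := by
  refine Finset.prod_ne_zero_iff.mpr fun i hi => mul_ne_zero (pow_ne_zero _ ?_) ?_
  · have := (Finset.mem_Icc.mp hi).1
    exact Nat.cast_ne_zero.mpr (by omega)
  · exact Nat.cast_ne_zero.mpr (Nat.factorial_ne_zero _)

theorem sum_perm_eq_sum_partition {n : ℕ} (c : ℕ → ℚ) :
    (1 / (n.factorial : ℚ)) • ∑ w : Equiv.Perm (Fin n), c (len w.partition) • powPart w.partition =
      ∑ μ : n.Partition, ((zee μ)⁻¹ * c (len μ)) • powPart μ := by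
  have h1 : ∀ m, m = n → ∑ μ : m.Partition, ((zee μ)⁻¹ * c (len μ)) • powPart μ =
      ∑ μ : n.Partition, ((zee μ)⁻¹ * c (len μ)) • powPart μ := by
    rintro m rfl
    rfl
  have h0 : (n.factorial : ℚ) ≠ 0 := Nat.cast_ne_zero.mpr (Nat.factorial_ne_zero _)
  rw [← h1 _ (Fintype.card_fin n), ← Finset.sum_fiberwise (s := Finset.univ)
    (g := fun w : Equiv.Perm (Fin n) => w.partition), Finset.smul_sum]
  refine Finset.sum_congr rfl fun μ _ => ?_
  have h2 : ∀ w ∈ Finset.univ.filter (fun w : Equiv.Perm (Fin n) => w.partition = μ),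
      c (len w.partition) • powPart w.partition = c (len μ) • powPart μ := by
    intro w hw
    rw [(Finset.mem_filter.mp hw).2]
  have h3 := card_partition_eq_mul_zee μ
  have h4 := zee_ne_zero μ
  have h5 := congrArg (fun m : ℕ => (m.factorial : ℚ)) (Fintype.card_fin n)
  replace h3 := h3.trans h5
  rw [Finset.sum_congr rfl h2, Finset.sum_const, ← Nat.cast_smul_eq_nsmul ℚ, smul_smul, smul_smul]
  congr 1
  field_simp
  rw [← h3]
  ring

theorem F_eq_coeff_H_pow {r k : ℕ} (hk : 1 ≤ k) (n : ℕ) :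
    F r k n = ((k : ℚ) / (r * n + k)) • PowerSeries.coeff n (H ^ (r * n + k)) := by
  have hM : ((r * n + k : ℕ) : ℚ) ≠ 0 := Nat.cast_ne_zero.mpr (by omega)
  have h1 : ∀ w : Equiv.Perm (Fin n), (Nat.card (MulAction.fixedBy (PF r k n) w) : ℚ) =
      (k : ℚ) / (r * n + k) * ((r * n + k : ℕ) : ℚ) ^ len w.partition := by
    intro w
    have h := congrArg (Nat.cast (R := ℚ)) (card_fixedBy_PF (r := r) rfl hk w)
    push_cast at h hM ⊢
    field_simp
    exact h
  rw [F, frobeniusChar, coeff_H_pow_power]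
  simp only [h1]
  rw [sum_perm_eq_sum_partition fun l => (k : ℚ) / (r * n + k) * ((r * n + k : ℕ) : ℚ) ^ l,
    Finset.smul_sum]
  refine Finset.sum_congr rfl fun μ _ => ?_
  rw [smul_smul]
  congr 1
  ring

namespace Young

theorem ext_rowLen {μ ν : YoungDiagram} (h : ∀ i, μ.rowLen i = ν.rowLen i) : μ = ν := by
  refine YoungDiagram.ext (Finset.ext fun c => ?_)
  obtain ⟨i, j⟩ := c
  rw [YoungDiagram.mem_cells, YoungDiagram.mem_cells, YoungDiagram.mem_iff_lt_rowLen,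
    YoungDiagram.mem_iff_lt_rowLen, h]

open Classical in
/-- The Young diagram with row lengths `f i`. -/
def ofRows (f : ℕ → ℕ) : YoungDiagram :=
  if h : Antitone f ∧ ∃ B, f B = 0 then
    { cells := (Finset.range h.2.choose ×ˢ Finset.range (f 0)).filter fun c => c.2 < f c.1
      isLowerSet := by
        rintro ⟨i, j⟩ ⟨i', j'⟩ hle hc
        simp only [Finset.coe_filter, Finset.mem_product, Finset.mem_range, Set.mem_ofPred_eq] at hc ⊢
        have h1 : i' ≤ i := hle.1
        have h2 : j' ≤ j := hle.2
        have h3 := h.1 h1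
        omega }
  else ⊥

theorem rowLen_ofRows {f : ℕ → ℕ} (h1 : Antitone f) (h2 : ∃ B, f B = 0) (i : ℕ) :
    (ofRows f).rowLen i = f i := by
  have hmem : ∀ j, (i, j) ∈ ofRows f ↔ j < f i := by
    intro j
    have h : Antitone f ∧ ∃ B, f B = 0 := ⟨h1, h2⟩
    rw [ofRows, dif_pos h, ← YoungDiagram.mem_cells, Finset.mem_filter, Finset.mem_product,
      Finset.mem_range, Finset.mem_range]
    refine ⟨fun h => h.2, fun hj => ⟨⟨?_, lt_of_lt_of_le hj (h1 (Nat.zero_le i))⟩, hj⟩⟩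
    by_contra hi
    have h3 := h1 (not_lt.mp hi)
    exact absurd (hj.trans_le (h3.trans h.2.choose_spec.le)) (Nat.not_lt_zero _)
  apply le_antisymm
  · by_contra hlt
    have := (hmem (f i)).mp (YoungDiagram.mem_iff_lt_rowLen.mpr (not_le.mp hlt))
    omega
  · by_contra hlt
    have := YoungDiagram.mem_iff_lt_rowLen.mp ((hmem _).mpr (not_le.mp hlt))
    omega

theorem exists_rowLen_eq_zero (μ : YoungDiagram) : ∃ B, μ.rowLen B = 0 := by
  refine ⟨μ.colLen 0, ?_⟩
  by_contra h
  have h1 := YoungDiagram.mem_iff_lt_rowLen.mpr (Nat.pos_of_ne_zero h)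
  rw [YoungDiagram.mem_iff_lt_colLen] at h1
  omega

theorem card_eq_sum_rowLen (μ : YoungDiagram) {B : ℕ} (hB : μ.rowLen B = 0) :
    μ.card = ∑ i ∈ Finset.range B, μ.rowLen i := by
  rw [YoungDiagram.card, Finset.card_eq_sum_card_fiberwise (f := Prod.fst) (t := Finset.range B)]
  · exact Finset.sum_congr rfl fun i _ => (μ.rowLen_eq_card).symm
  · rintro ⟨i, j⟩ hc
    rw [Finset.mem_coe, YoungDiagram.mem_cells, YoungDiagram.mem_iff_lt_rowLen] at hc
    rw [Finset.mem_coe, Finset.mem_range]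
    by_contra hi
    have := μ.rowLen_anti B i (not_lt.mp hi)
    omega

theorem rowLens_diagram {n : ℕ} (μ : n.Partition) :
    (diagram μ).rowLens = μ.parts.sort (· ≥ ·) :=
  YoungDiagram.rowLens_ofRowLens_eq_self fun _ hx => μ.parts_pos ((Multiset.mem_sort _).mp hx)

theorem diagram_injective {n : ℕ} : Function.Injective (diagram : n.Partition → _) := by
  intro μ ν h
  apply Nat.Partition.ext
  rw [← Multiset.sort_eq μ.parts (· ≥ ·), ← Multiset.sort_eq ν.parts (· ≥ ·), ← rowLens_diagram,
    h, rowLens_diagram]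

/-- The Young diagrams with `n` cells. -/
def diagrams (n : ℕ) : Finset YoungDiagram :=
  Finset.univ.map (⟨diagram, diagram_injective⟩ : n.Partition ↪ YoungDiagram)

theorem sum_rowLens (μ : YoungDiagram) : μ.rowLens.sum = μ.card := by
  have h : μ.rowLen (μ.colLen 0) = 0 := by
    by_contra h
    have h1 := YoungDiagram.mem_iff_lt_rowLen.mpr (Nat.pos_of_ne_zero h)
    rw [YoungDiagram.mem_iff_lt_colLen] at h1
    omega
  rw [card_eq_sum_rowLen μ h, YoungDiagram.rowLens]
  rfl

theorem mem_diagrams {n : ℕ} {μ : YoungDiagram} : μ ∈ diagrams n ↔ μ.card = n := by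
  rw [diagrams, Finset.mem_map]
  constructor
  · rintro ⟨μ, -, rfl⟩
    change (diagram μ).card = n
    rw [← sum_rowLens, rowLens_diagram, ← Multiset.sum_coe, Multiset.sort_eq, μ.parts_sum]
  · intro h
    refine ⟨⟨μ.rowLens, fun hi => μ.pos_of_mem_rowLens _ hi, by
      rw [Multiset.sum_coe, sum_rowLens, h]⟩, Finset.mem_univ _, ?_⟩
    refine YoungDiagram.equivListRowLens.injective (Subtype.ext ?_)
    refine (rowLens_diagram _).trans ?_
    exact List.mergeSort_eq_self _ μ.rowLens_sorted.pairwise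

theorem sum_diagrams {n : ℕ} (f : YoungDiagram → ℚ) :
    ∑ μ ∈ diagrams n, f μ = ∑ μ : n.Partition, f (diagram μ) := by
  rw [diagrams, Finset.sum_map]
  rfl

/-- `μ / ν` is a horizontal strip. -/
def HStrip (ν μ : YoungDiagram) : Prop :=
  ∀ i, ν.rowLen i ≤ μ.rowLen i ∧ μ.rowLen (i + 1) ≤ ν.rowLen i

theorem HStrip.le {ν μ : YoungDiagram} (h : HStrip ν μ) : ν ≤ μ := by
  rintro ⟨i, j⟩ hc
  have h1 := (h i).1
  have h2 : j < ν.rowLen i := YoungDiagram.mem_iff_lt_rowLen.mp hc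
  exact YoungDiagram.mem_iff_lt_rowLen.mpr (by omega)

theorem HStrip.card_le {ν μ : YoungDiagram} (h : HStrip ν μ) : ν.card ≤ μ.card :=
  Finset.card_le_card (YoungDiagram.cells_subset_iff.mpr h.le)

theorem HStrip.mem {ν μ : YoungDiagram} (h : HStrip ν μ) {i j : ℕ} (hm : (i + 1, j) ∈ μ) :
    (i, j) ∈ ν := by
  rw [YoungDiagram.mem_iff_lt_rowLen] at hm ⊢
  have := (h i).2
  omega

theorem HStrip.of_mem {ν μ : YoungDiagram} (h1 : ν ≤ μ)
    (h2 : ∀ i j, (i + 1, j) ∈ μ → (i, j) ∈ ν) : HStrip ν μ := by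
  intro i
  constructor
  · by_contra h
    have h3 := h1 (YoungDiagram.mem_iff_lt_rowLen.mpr (not_le.mp h))
    have h4 := YoungDiagram.mem_iff_lt_rowLen.mp h3
    omega
  · by_contra h
    have h3 := h2 i _ (YoungDiagram.mem_iff_lt_rowLen.mpr (not_le.mp h))
    have h4 := YoungDiagram.mem_iff_lt_rowLen.mp h3
    omega

open Classical in
/-- The diagrams obtained from `μ` by removing a horizontal strip. -/
def below (μ : YoungDiagram) : Finset YoungDiagram :=
  ((Finset.range (μ.card + 1)).biUnion diagrams).filter fun ν => HStrip ν μ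

theorem mem_below {ν μ : YoungDiagram} : ν ∈ below μ ↔ HStrip ν μ := by
  classical
  rw [below, Finset.mem_filter, Finset.mem_biUnion, and_iff_right_iff_imp]
  intro h
  exact ⟨ν.card, Finset.mem_range.mpr (Nat.lt_succ_of_le h.card_le), mem_diagrams.mpr rfl⟩

open Classical in
/-- The diagrams obtained from `ν` by adding a horizontal strip of size `a`. -/
def above (a : ℕ) (ν : YoungDiagram) : Finset YoungDiagram :=
  (diagrams (ν.card + a)).filter fun μ => HStrip ν μ

theorem mem_above {a : ℕ} {ν μ : YoungDiagram} :
    μ ∈ above a ν ↔ μ.card = ν.card + a ∧ HStrip ν μ := by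
  classical
  rw [above, Finset.mem_filter, mem_diagrams]

/-- The local rule of the Robinson–Schensted–Knuth correspondence, on row lengths. -/
def LocalRule (l μ κ ν : YoungDiagram) (j : ℕ) : Prop :=
  ν.rowLen 0 = max (l.rowLen 0) (μ.rowLen 0) + j ∧
  ∀ i, ν.rowLen (i + 1) + κ.rowLen i =
    max (l.rowLen (i + 1)) (μ.rowLen (i + 1)) + min (l.rowLen i) (μ.rowLen i)

theorem LocalRule.card {l μ κ ν : YoungDiagram} {j : ℕ} (h : LocalRule l μ κ ν j) :
    ν.card + κ.card = l.card + μ.card + j := by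
  obtain ⟨B1, h1⟩ := exists_rowLen_eq_zero l
  obtain ⟨B2, h2⟩ := exists_rowLen_eq_zero μ
  obtain ⟨B3, h3⟩ := exists_rowLen_eq_zero κ
  obtain ⟨B4, h4⟩ := exists_rowLen_eq_zero ν
  obtain ⟨B, hB⟩ : ∃ B, B = B1 + B2 + B3 + B4 := ⟨_, rfl⟩
  have hz : ∀ (ρ : YoungDiagram) (C : ℕ), ρ.rowLen C = 0 → ∀ D, C ≤ D → ρ.rowLen D = 0 := by
    intro ρ C hC D hD
    have := ρ.rowLen_anti C D hD
    omega
  rw [card_eq_sum_rowLen ν (hz _ _ h4 (B + 1) (by omega)),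
    card_eq_sum_rowLen κ (hz _ _ h3 B (by omega)),
    card_eq_sum_rowLen l (hz _ _ h1 (B + 1) (by omega)),
    card_eq_sum_rowLen μ (hz _ _ h2 (B + 1) (by omega)), Finset.sum_range_succ', h.1,
    ← Finset.sum_add_distrib]
  have h5 : ∑ i ∈ Finset.range B, (ν.rowLen (i + 1) + κ.rowLen i) =
      ∑ i ∈ Finset.range B, (max (l.rowLen (i + 1)) (μ.rowLen (i + 1)) +
        min (l.rowLen i) (μ.rowLen i)) := Finset.sum_congr rfl fun i _ => h.2 i
  have h6 : ∑ i ∈ Finset.range (B + 1), (l.rowLen i + μ.rowLen i) =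
      ∑ i ∈ Finset.range (B + 1), (max (l.rowLen i) (μ.rowLen i) +
        min (l.rowLen i) (μ.rowLen i)) :=
    Finset.sum_congr rfl fun i _ => (max_add_min _ _).symm
  have h7 : min (l.rowLen B) (μ.rowLen B) = 0 := by
    rw [hz _ _ h1 B (by omega)]
    exact Nat.zero_min _
  rw [Finset.sum_add_distrib, Finset.sum_add_distrib, Finset.sum_range_succ' (fun i => max _ _),
    Finset.sum_range_succ (fun i => min _ _), h7] at h6
  rw [Finset.sum_add_distrib, Finset.sum_add_distrib] at h5
  rw [Finset.sum_add_distrib]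
  omega

/-- The diagram above in the local rule. -/
def up (l μ κ : YoungDiagram) (j : ℕ) : YoungDiagram := ofRows fun
  | 0 => max (l.rowLen 0) (μ.rowLen 0) + j
  | i + 1 => max (l.rowLen (i + 1)) (μ.rowLen (i + 1)) + min (l.rowLen i) (μ.rowLen i) - κ.rowLen i

/-- The diagram below in the local rule. -/
def down (l μ ν : YoungDiagram) : YoungDiagram := ofRows fun i =>
  max (l.rowLen (i + 1)) (μ.rowLen (i + 1)) + min (l.rowLen i) (μ.rowLen i) - ν.rowLen (i + 1)

theorem up_spec {l μ κ : YoungDiagram} (hl : HStrip κ l) (hμ : HStrip κ μ) (j : ℕ) :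
    LocalRule l μ κ (up l μ κ j) j ∧ HStrip l (up l μ κ j) ∧ HStrip μ (up l μ κ j) := by
  have hlen := rowLen_ofRows (f := fun
    | 0 => max (l.rowLen 0) (μ.rowLen 0) + j
    | i + 1 => max (l.rowLen (i + 1)) (μ.rowLen (i + 1)) + min (l.rowLen i) (μ.rowLen i) -
        κ.rowLen i) (antitone_nat_of_succ_le fun i => by
      rcases i with _ | i
      · have := hl 0
        have := hμ 0
        simp only
        omega
      · have := hl i
        have := hμ i
        have := hl (i + 1)
        have := hμ (i + 1)
        simp only
        omega) (by
      obtain ⟨B1, h1⟩ := exists_rowLen_eq_zero l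
      obtain ⟨B2, h2⟩ := exists_rowLen_eq_zero μ
      have := l.rowLen_anti B1 (B1 + B2) (by omega)
      have := μ.rowLen_anti B2 (B1 + B2) (by omega)
      have := l.rowLen_anti B1 (B1 + B2 + 1) (by omega)
      have := μ.rowLen_anti B2 (B1 + B2 + 1) (by omega)
      refine ⟨B1 + B2 + 1, ?_⟩
      simp only
      omega)
  have h0 : (up l μ κ j).rowLen 0 = max (l.rowLen 0) (μ.rowLen 0) + j := hlen 0
  have hs : ∀ i, (up l μ κ j).rowLen (i + 1) = max (l.rowLen (i + 1)) (μ.rowLen (i + 1)) +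
      min (l.rowLen i) (μ.rowLen i) - κ.rowLen i := fun i => hlen (i + 1)
  refine ⟨⟨h0, fun i => ?_⟩, fun i => ?_, fun i => ?_⟩
  · have := hl i
    have := hμ i
    rw [hs]
    omega
  all_goals
    have h1 := hl i
    have h2 := hμ i
    rw [hs]
    rcases i with _ | i
    · rw [h0]
      omega
    · have h3 := hl i
      have h4 := hμ i
      rw [hs]
      omega

theorem down_spec {l μ ν : YoungDiagram} (hl : HStrip l ν) (hμ : HStrip μ ν) :
    LocalRule l μ (down l μ ν) ν (ν.rowLen 0 - max (l.rowLen 0) (μ.rowLen 0)) ∧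
      HStrip (down l μ ν) l ∧ HStrip (down l μ ν) μ := by
  have hs : ∀ i, (down l μ ν).rowLen i = max (l.rowLen (i + 1)) (μ.rowLen (i + 1)) +
      min (l.rowLen i) (μ.rowLen i) - ν.rowLen (i + 1) := by
    refine rowLen_ofRows (antitone_nat_of_succ_le fun i => ?_) ?_
    · have := hl i
      have := hμ i
      have := hl (i + 1)
      have := hμ (i + 1)
      have := hl (i + 1 + 1)
      have := hμ (i + 1 + 1)
      omega
    · obtain ⟨B1, h1⟩ := exists_rowLen_eq_zero l
      obtain ⟨B2, h2⟩ := exists_rowLen_eq_zero μ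
      have := l.rowLen_anti B1 (B1 + B2) (by omega)
      have := μ.rowLen_anti B2 (B1 + B2) (by omega)
      have := l.rowLen_anti B1 (B1 + B2 + 1) (by omega)
      have := μ.rowLen_anti B2 (B1 + B2 + 1) (by omega)
      refine ⟨B1 + B2, ?_⟩
      omega
  refine ⟨⟨?_, fun i => ?_⟩, fun i => ?_, fun i => ?_⟩
  · have := hl 0
    have := hμ 0
    omega
  all_goals
    have h1 := hl i
    have h2 := hμ i
    have h3 := hl (i + 1)
    have h4 := hμ (i + 1)
    rw [hs]
    omega

theorem LocalRule.up_eq {l μ κ ν : YoungDiagram} {j : ℕ} (h : LocalRule l μ κ ν j)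
    (hl : HStrip κ l) (hμ : HStrip κ μ) : up l μ κ j = ν := by
  have h' := (up_spec hl hμ j).1
  refine ext_rowLen fun i => ?_
  rcases i with _ | i
  · rw [h'.1, h.1]
  · have h1 := h'.2 i
    have h2 := h.2 i
    omega

theorem LocalRule.down_eq {l μ κ ν : YoungDiagram} {j : ℕ} (h : LocalRule l μ κ ν j)
    (hl : HStrip l ν) (hμ : HStrip μ ν) : down l μ ν = κ := by
  have h' := (down_spec hl hμ).1
  refine ext_rowLen fun i => ?_
  have h1 := h'.2 i
  have h2 := h.2 i
  omega

/-- Adding and then removing a horizontal strip. -/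
theorem sum_above_below (a : ℕ) (l : YoungDiagram) (f : YoungDiagram → ℚ) :
    ∑ ν ∈ above a l, ∑ μ ∈ below ν, f μ =
      ∑ j ∈ Finset.range (a + 1), ∑ κ ∈ below l, ∑ μ ∈ above (a - j) κ, f μ := by
  rw [Finset.sum_sigma']
  simp only [Finset.sum_sigma']
  refine Finset.sum_bij'
    (fun p _ => ⟨p.1.rowLen 0 - max (l.rowLen 0) (p.2.rowLen 0), ⟨down l p.2 p.1, p.2⟩⟩)
    (fun q _ => ⟨up l q.2.2 q.2.1 q.1, q.2.2⟩) ?_ ?_ ?_ ?_ ?_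
  · rintro ⟨ν, μ⟩ h
    simp only [Finset.mem_sigma, mem_above, mem_below, Finset.mem_range] at h ⊢
    obtain ⟨⟨h1, h2⟩, h3⟩ := h
    obtain ⟨h4, h5, h6⟩ := down_spec h2 h3
    have h7 := h4.card
    have h8 := h6.card_le
    exact ⟨by omega, h5, by omega, h6⟩
  · rintro ⟨j, κ, μ⟩ h
    simp only [Finset.mem_sigma, mem_above, mem_below, Finset.mem_range] at h ⊢
    obtain ⟨h1, h2, h3, h4⟩ := h
    obtain ⟨h5, h6, h7⟩ := up_spec h2 h4 j
    have h8 := h5.card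
    exact ⟨⟨by omega, h6⟩, h7⟩
  · rintro ⟨ν, μ⟩ h
    simp only [Finset.mem_sigma, mem_above, mem_below] at h
    obtain ⟨h4, h5, h6⟩ := down_spec h.1.2 h.2
    simp only [h4.up_eq h5 h6]
  · rintro ⟨j, κ, μ⟩ h
    simp only [Finset.mem_sigma, mem_above, mem_below] at h
    obtain ⟨h5, h6, h7⟩ := up_spec h.2.1 h.2.2.2 j
    simp only [h5.down_eq h6 h7, h5.1, Nat.add_sub_cancel_left]
  · intro p _
    rfl

open Classical in
/-- The weighted count of chains of `m` horizontal strips from the empty diagram to `μ`. -/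
def chainWeight (w : ℕ → ℕ → ℚ) : ℕ → YoungDiagram → ℚ
  | 0, μ => if μ = ⊥ then 1 else 0
  | m + 1, μ => ∑ ν ∈ below μ, w m (μ.card - ν.card) * chainWeight w m ν

theorem card_bot : (⊥ : YoungDiagram).card = 0 := rfl

theorem eq_bot_of_card {μ : YoungDiagram} (h : μ.card = 0) : μ = ⊥ :=
  YoungDiagram.ext (Finset.card_eq_zero.mp h)

theorem sum_above_bot (a : ℕ) (w : ℕ → ℕ → ℚ) (ν : YoungDiagram) :
    ∑ μ ∈ above a ν, chainWeight w 0 μ = if a = 0 then chainWeight w 0 ν else 0 := by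
  classical
  have h1 : ∀ μ ∈ above a ν, chainWeight w 0 μ ≠ 0 → ν = ⊥ ∧ a = 0 ∧ μ = ⊥ := by
    intro μ hμ h
    have h2 : μ = ⊥ := by
      by_contra h2
      exact h (if_neg h2)
    have h3 := (mem_above.mp hμ).1
    rw [h2, card_bot] at h3
    exact ⟨eq_bot_of_card (by omega), by omega, h2⟩
  by_cases h : ν = ⊥ ∧ a = 0
  · obtain ⟨rfl, rfl⟩ := h
    rw [if_pos rfl, Finset.sum_eq_single ⊥]
    · intro μ hμ hne
      by_contra h
      exact hne (h1 μ hμ h).2.2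
    · intro hn
      exact absurd (mem_above.mpr ⟨rfl, fun i => ⟨le_rfl, YoungDiagram.rowLen_anti _ _ _ (by omega)⟩⟩) hn
  · rw [Finset.sum_eq_zero]
    · symm
      by_cases ha : a = 0
      · rw [if_pos ha]
        exact if_neg fun hν => h ⟨hν, ha⟩
      · rw [if_neg ha]
    · intro μ hμ
      by_contra h2
      exact h ⟨(h1 μ hμ h2).1, (h1 μ hμ h2).2.1⟩

/-- The number of semistandard tableaux with entries less than `N`, as a function of the shape, is
an eigenvector of the operator adding a horizontal strip. -/
theorem sum_above_chainWeight (N : ℕ) : ∀ (a : ℕ) (ν : YoungDiagram),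
    ∑ μ ∈ above a ν, chainWeight (fun _ _ => 1) N μ =
      PowerSeries.coeff a ((PowerSeries.mk 1 : PowerSeries ℚ) ^ N) *
        chainWeight (fun _ _ => 1) N ν := by
  induction N with
  | zero =>
    intro a ν
    rw [sum_above_bot, pow_zero, PowerSeries.coeff_one, ite_mul, one_mul, zero_mul]
  | succ N ih =>
    intro a ν
    simp only [chainWeight, one_mul]
    rw [sum_above_below]
    simp only [ih]
    simp only [← Finset.mul_sum, ← Finset.sum_mul]
    congr 1
    rw [pow_succ, PowerSeries.coeff_mul,
      Finset.Nat.sum_antidiagonal_eq_sum_range_succ_mk, ← Finset.sum_range_reflect]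
    refine Finset.sum_congr rfl fun j hj => ?_
    rw [PowerSeries.coeff_mk, Pi.one_apply, mul_one]
    have := Finset.mem_range.mp hj
    congr 2
    dsimp only
    omega

theorem chainWeight_bot (N : ℕ) : chainWeight (fun _ _ => 1) N ⊥ = 1 := by
  induction N with
  | zero => exact if_pos rfl
  | succ N ih =>
    have h : below ⊥ = {⊥} := by
      ext ν
      rw [mem_below, Finset.mem_singleton]
      constructor
      · intro h
        exact le_bot_iff.mp h.le
      · rintro rfl
        exact fun i => ⟨le_rfl, YoungDiagram.rowLen_anti _ _ _ (by omega)⟩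
    simp only [chainWeight, h, Finset.sum_singleton, ih, mul_one]

open Classical in
/-- The weight selecting tableaux of content `d`. -/
def contentWeight (d : ℕ → ℕ) (i t : ℕ) : ℚ := if t = d i then 1 else 0

theorem sum_contentWeight (d : ℕ → ℕ) (N m : ℕ) :
    ∑ μ ∈ diagrams (∑ i ∈ Finset.range m, d i),
      chainWeight (contentWeight d) m μ * chainWeight (fun _ _ => 1) N μ =
      ∏ i ∈ Finset.range m, PowerSeries.coeff (d i) ((PowerSeries.mk 1 : PowerSeries ℚ) ^ N) := by
  induction m with
  | zero =>
    rw [Finset.sum_range_zero, Finset.prod_range_zero, Finset.sum_eq_single ⊥]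
    · rw [chainWeight_bot, mul_one]
      exact if_pos rfl
    · intro μ hμ h
      exact absurd (eq_bot_of_card (mem_diagrams.mp hμ)) h
    · intro h
      exact absurd (mem_diagrams.mpr card_bot) h
  | succ m ih =>
    rw [Finset.prod_range_succ, ← ih, Finset.sum_mul]
    have h1 : ∀ ν : YoungDiagram, chainWeight (contentWeight d) m ν *
        chainWeight (fun _ _ => 1) N ν *
          PowerSeries.coeff (d m) ((PowerSeries.mk 1 : PowerSeries ℚ) ^ N) =
        ∑ μ ∈ above (d m) ν, chainWeight (contentWeight d) m ν *
          chainWeight (fun _ _ => 1) N μ := by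
      intro ν
      rw [← Finset.mul_sum, sum_above_chainWeight]
      ring
    simp only [h1]
    have h2 : ∀ μ : YoungDiagram, chainWeight (contentWeight d) (m + 1) μ *
        chainWeight (fun _ _ => 1) N μ =
        ∑ ν ∈ (below μ).filter (fun ν => μ.card - ν.card = d m),
          chainWeight (contentWeight d) m ν * chainWeight (fun _ _ => 1) N μ := by
      intro μ
      rw [chainWeight, Finset.sum_mul, Finset.sum_filter]
      refine Finset.sum_congr rfl fun ν _ => ?_
      rw [contentWeight]
      split_ifs <;> ring
    simp only [h2]
    refine Finset.sum_comm' fun μ ν => ?_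
    rw [Finset.mem_filter, mem_below, mem_above, mem_diagrams, mem_diagrams,
      Finset.sum_range_succ]
    constructor
    · rintro ⟨h3, h4, h5⟩
      have := h4.card_le
      exact ⟨⟨by omega, h4⟩, by omega⟩
    · rintro ⟨⟨h3, h4⟩, h5⟩
      exact ⟨by omega, h4, by omega⟩

theorem chainWeight_contentWeight_eq_zero (d : ℕ → ℕ) (m : ℕ) : ∀ μ : YoungDiagram,
    μ.card ≠ ∑ i ∈ Finset.range m, d i → chainWeight (contentWeight d) m μ = 0 := by
  induction m with
  | zero =>
    intro μ h
    refine if_neg ?_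
    rintro rfl
    exact h card_bot
  | succ m ih =>
    intro μ h
    rw [chainWeight]
    refine Finset.sum_eq_zero fun ν hν => ?_
    rw [contentWeight]
    split_ifs with h1
    · rw [one_mul]
      refine ih ν fun h2 => h ?_
      have := (mem_below.mp hν).card_le
      rw [Finset.sum_range_succ]
      omega
    · rw [zero_mul]

/-- The number of entries of a tableau equal to `i`. -/
def entryCount {μ : YoungDiagram} (T : SemistandardYoungTableau μ) (i : ℕ) : ℕ :=
  (μ.cells.filter fun c => T c.1 c.2 = i).card

/-- Semistandard tableaux with entries less than `m`. -/
abbrev BoundedTableau (m : ℕ) (μ : YoungDiagram) : Type :=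
  {T : SemistandardYoungTableau μ // ∀ i j, (i, j) ∈ μ → T i j < m}

instance (m : ℕ) (μ : YoungDiagram) : Finite (BoundedTableau m μ) := by
  refine Finite.of_injective (β := μ.cells → Fin m)
    (fun T c => ⟨T.1 c.1.1 c.1.2, T.2 _ _ (YoungDiagram.mem_cells _ |>.mp c.2)⟩) ?_
  intro T T' h
  refine Subtype.ext (SemistandardYoungTableau.ext fun i j => ?_)
  by_cases hc : (i, j) ∈ μ
  · exact congrArg Fin.val (congrFun h ⟨(i, j), (YoungDiagram.mem_cells _).mpr hc⟩)
  · rw [T.1.zeros hc, T'.1.zeros hc]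

instance (m : ℕ) (μ : YoungDiagram) : Fintype (BoundedTableau m μ) := Fintype.ofFinite _

/-- The cells of a tableau with entries less than `m`. -/
def restrictShape {μ : YoungDiagram} (T : SemistandardYoungTableau μ) (m : ℕ) : YoungDiagram where
  cells := μ.cells.filter fun c => T c.1 c.2 < m
  isLowerSet := by
    rintro ⟨i, j⟩ ⟨i', j'⟩ hle hc
    rw [Finset.mem_coe, Finset.mem_filter, YoungDiagram.mem_cells] at hc ⊢
    have h1 : i' ≤ i := hle.1
    have h2 : j' ≤ j := hle.2
    have h3 : (i, j') ∈ μ := μ.up_left_mem le_rfl h2 hc.1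
    refine ⟨μ.up_left_mem h1 h2 hc.1, ?_⟩
    exact ((T.col_weak h1 h3).trans (T.row_weak_of_le h2 hc.1)).trans_lt hc.2

theorem mem_restrictShape {μ : YoungDiagram} {T : SemistandardYoungTableau μ} {m i j : ℕ} :
    (i, j) ∈ restrictShape T m ↔ (i, j) ∈ μ ∧ T i j < m := by
  rw [← YoungDiagram.mem_cells, restrictShape, Finset.mem_filter, YoungDiagram.mem_cells]

theorem hStrip_restrictShape {μ : YoungDiagram} {m : ℕ} (T : BoundedTableau (m + 1) μ) :
    HStrip (restrictShape T.1 m) μ := by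
  refine HStrip.of_mem (fun c hc => (mem_restrictShape.mp hc).1) fun i j h => ?_
  rw [mem_restrictShape]
  refine ⟨μ.up_left_mem (Nat.le_succ i) le_rfl h, ?_⟩
  have h1 := T.1.col_strict (i1 := i) (i2 := i + 1) (by omega) h
  have h2 := T.2 _ _ h
  omega

open Classical in
/-- Removing the largest entry. -/
def restrictTableau {μ ν : YoungDiagram} (T : SemistandardYoungTableau μ) (h : ν ≤ μ) :
    SemistandardYoungTableau ν where
  entry i j := if (i, j) ∈ ν then T i j else 0
  row_weak' := by
    intro i j1 j2 hj hc
    rw [if_pos hc, if_pos (ν.up_left_mem le_rfl hj.le hc)]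
    exact T.row_weak hj (h hc)
  col_strict' := by
    intro i1 i2 j hi hc
    rw [if_pos hc, if_pos (ν.up_left_mem hi.le le_rfl hc)]
    exact T.col_strict hi (h hc)
  zeros' := fun hc => if_neg hc

open Classical in
/-- Filling a horizontal strip with a new largest entry. -/
def extendTableau {μ ν : YoungDiagram} {m : ℕ} (S : BoundedTableau m ν) (h : HStrip ν μ) :
    SemistandardYoungTableau μ where
  entry i j := if (i, j) ∈ ν then S.1 i j else if (i, j) ∈ μ then m else 0
  row_weak' := by
    intro i j1 j2 hj hc
    have hc1 := μ.up_left_mem le_rfl hj.le hc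
    by_cases h2 : (i, j2) ∈ ν
    · rw [if_pos h2, if_pos (ν.up_left_mem le_rfl hj.le h2)]
      exact S.1.row_weak hj h2
    · rw [if_neg h2, if_pos hc, if_pos hc1]
      split_ifs with h3
      · exact (S.2 _ _ h3).le
      · exact le_rfl
  col_strict' := by
    intro i1 i2 j hi hc
    by_cases h2 : (i2, j) ∈ ν
    · rw [if_pos h2, if_pos (ν.up_left_mem hi.le le_rfl h2)]
      exact S.1.col_strict hi h2
    · obtain ⟨i, rfl⟩ : ∃ i, i2 = i + 1 := ⟨i2 - 1, by omega⟩
      have h3 : (i1, j) ∈ ν := ν.up_left_mem (Nat.lt_succ_iff.mp hi) le_rfl (h.mem hc)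
      rw [if_neg h2, if_pos hc, if_pos h3]
      exact S.2 _ _ h3
  zeros' := by
    intro i j hc
    rw [if_neg fun h2 => hc (h.le h2), if_neg hc]

theorem restrictTableau_apply {μ ν : YoungDiagram} (T : SemistandardYoungTableau μ) (h : ν ≤ μ)
    {i j : ℕ} (hc : (i, j) ∈ ν) : restrictTableau T h i j = T i j := if_pos hc

theorem extendTableau_apply {μ ν : YoungDiagram} {m : ℕ} (S : BoundedTableau m ν)
    (h : HStrip ν μ) {i j : ℕ} (hc : (i, j) ∈ ν) : extendTableau S h i j = S.1 i j := if_pos hc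

theorem extendTableau_apply' {μ ν : YoungDiagram} {m : ℕ} (S : BoundedTableau m ν)
    (h : HStrip ν μ) {i j : ℕ} (hc : (i, j) ∉ ν) (hc' : (i, j) ∈ μ) :
    extendTableau S h i j = m := (if_neg hc).trans (if_pos hc')

/-- Tableaux whose entries less than `m` fill `ν` correspond to tableaux of shape `ν`. -/
def restrictEquiv {μ ν : YoungDiagram} (m : ℕ) (h : HStrip ν μ) :
    {T : BoundedTableau (m + 1) μ // restrictShape T.1 m = ν} ≃ BoundedTableau m ν where
  toFun T := ⟨restrictTableau T.1.1 h.le, fun i j hc => by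
    rw [restrictTableau_apply _ _ hc]
    rw [← T.2] at hc
    exact (mem_restrictShape.mp hc).2⟩
  invFun S := ⟨⟨extendTableau S h, fun i j hc => by
      by_cases h2 : (i, j) ∈ ν
      · rw [extendTableau_apply _ _ h2]
        exact (S.2 _ _ h2).trans (Nat.lt_succ_self m)
      · rw [extendTableau_apply' _ _ h2 hc]
        exact Nat.lt_succ_self m⟩, by
      refine YoungDiagram.ext (Finset.ext fun ⟨i, j⟩ => ?_)
      rw [YoungDiagram.mem_cells, YoungDiagram.mem_cells, mem_restrictShape]
      constructor
      · rintro ⟨h1, h2⟩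
        by_contra h3
        rw [extendTableau_apply' _ _ h3 h1] at h2
        exact lt_irrefl m h2
      · intro h1
        rw [extendTableau_apply _ _ h1]
        exact ⟨h.le h1, S.2 _ _ h1⟩⟩
  left_inv T := by
    refine Subtype.ext (Subtype.ext (SemistandardYoungTableau.ext fun i j => ?_))
    by_cases h1 : (i, j) ∈ ν
    · rw [extendTableau_apply _ _ h1]
      exact restrictTableau_apply _ h.le h1
    · by_cases h2 : (i, j) ∈ μ
      · rw [extendTableau_apply' _ _ h1 h2]
        have h3 := T.1.2 _ _ h2
        rw [← T.2, mem_restrictShape] at h1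
        by_contra h4
        exact h1 ⟨h2, by omega⟩
      · rw [SemistandardYoungTableau.zeros _ h2, SemistandardYoungTableau.zeros _ h2]
  right_inv S := by
    refine Subtype.ext (SemistandardYoungTableau.ext fun i j => ?_)
    by_cases h1 : (i, j) ∈ ν
    · refine (restrictTableau_apply _ h.le h1).trans ?_
      exact extendTableau_apply _ h h1
    · rw [SemistandardYoungTableau.zeros _ h1, SemistandardYoungTableau.zeros _ h1]

theorem entryCount_extendTableau {μ ν : YoungDiagram} {m : ℕ} (S : BoundedTableau m ν)
    (h : HStrip ν μ) {i : ℕ} (hi : i < m) :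
    entryCount (extendTableau S h) i = entryCount S.1 i := by
  rw [entryCount, entryCount]
  congr 1
  ext ⟨a, b⟩
  rw [Finset.mem_filter, Finset.mem_filter, YoungDiagram.mem_cells, YoungDiagram.mem_cells]
  by_cases h1 : (a, b) ∈ ν
  · rw [extendTableau_apply _ _ h1]
    exact ⟨fun h2 => ⟨h1, h2.2⟩, fun h2 => ⟨h.le h1, h2.2⟩⟩
  · constructor
    · rintro ⟨h2, h3⟩
      rw [extendTableau_apply' _ _ h1 h2] at h3
      omega
    · rintro ⟨h2, -⟩
      exact absurd h2 h1

theorem entryCount_extendTableau_self {μ ν : YoungDiagram} {m : ℕ} (S : BoundedTableau m ν)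
    (h : HStrip ν μ) : entryCount (extendTableau S h) m = μ.card - ν.card := by
  rw [entryCount, YoungDiagram.card, YoungDiagram.card,
    ← Finset.card_sdiff_of_subset (YoungDiagram.cells_subset_iff.mpr h.le)]
  congr 1
  ext ⟨a, b⟩
  rw [Finset.mem_filter, Finset.mem_sdiff, YoungDiagram.mem_cells, YoungDiagram.mem_cells]
  refine and_congr_right fun h1 => ?_
  by_cases h2 : (a, b) ∈ ν
  · rw [extendTableau_apply _ _ h2]
    have := S.2 _ _ h2
    exact ⟨fun h3 => by omega, fun h3 => absurd h2 h3⟩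
  · exact ⟨fun _ => h2, fun _ => extendTableau_apply' _ _ h2 h1⟩

/-- Tableaux as chains of horizontal strips. -/
theorem sum_boundedTableau (w : ℕ → ℕ → ℚ) (m : ℕ) : ∀ μ : YoungDiagram,
    ∑ T : BoundedTableau m μ, ∏ i ∈ Finset.range m, w i (entryCount T.1 i) =
      chainWeight w m μ := by
  classical
  induction m with
  | zero =>
    intro μ
    rw [chainWeight]
    split_ifs with h
    · subst h
      have : Unique (BoundedTableau 0 (⊥ : YoungDiagram)) :=
        { default := ⟨default, fun i j h => absurd h (YoungDiagram.notMem_bot _)⟩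
          uniq := fun T => Subtype.ext (SemistandardYoungTableau.ext fun i j => by
            rw [SemistandardYoungTableau.zeros _ (YoungDiagram.notMem_bot _),
              SemistandardYoungTableau.zeros _ (YoungDiagram.notMem_bot _)]) }
      rw [Fintype.sum_unique, Finset.prod_range_zero]
    · have : IsEmpty (BoundedTableau 0 μ) := by
        refine ⟨fun T => h ?_⟩
        refine YoungDiagram.ext (Finset.eq_empty_of_forall_notMem fun c hc => ?_)
        exact Nat.not_lt_zero _ (T.2 c.1 c.2 ((YoungDiagram.mem_cells _).mp hc))
      rw [Fintype.sum_empty]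
  | succ m ih =>
    intro μ
    rw [chainWeight, ← Finset.sum_fiberwise_of_maps_to (t := below μ)
      (g := fun T : BoundedTableau (m + 1) μ => restrictShape T.1 m)
      fun T _ => mem_below.mpr (hStrip_restrictShape T)]
    refine Finset.sum_congr rfl fun ν hν => ?_
    rw [mem_below] at hν
    rw [← ih, Finset.mul_sum, Finset.sum_subtype (p := fun T : BoundedTableau (m + 1) μ =>
      restrictShape T.1 m = ν) _ (fun T => by simp)]
    refine (Fintype.sum_equiv (restrictEquiv m hν).symm _ _ fun S => ?_).symm
    change _ = ∏ i ∈ Finset.range (m + 1), w i (entryCount (extendTableau S hν) i)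
    rw [Finset.prod_range_succ, entryCount_extendTableau_self, mul_comm]
    congr 1
    refine Finset.prod_congr rfl fun i hi => ?_
    rw [entryCount_extendTableau S hν (Finset.mem_range.mp hi)]

theorem entryCount_eq_zero {m : ℕ} {μ : YoungDiagram} (T : BoundedTableau m μ) {i : ℕ}
    (hi : m ≤ i) : entryCount T.1 i = 0 := by
  rw [entryCount, Finset.card_eq_zero, Finset.filter_eq_empty_iff]
  rintro ⟨a, b⟩ hc h
  have := T.2 a b ((YoungDiagram.mem_cells _).mp hc)
  simp only at h
  omega

/-- The content of a tableau. -/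
def content {m : ℕ} {μ : YoungDiagram} (T : BoundedTableau m μ) : ℕ →₀ ℕ :=
  Finsupp.onFinset (Finset.range m) (entryCount T.1) fun i hi => by
    rw [Finset.mem_range]
    by_contra h
    exact hi (entryCount_eq_zero T (not_lt.mp h))

theorem content_apply {m : ℕ} {μ : YoungDiagram} (T : BoundedTableau m μ) (i : ℕ) :
    content T i = entryCount T.1 i := rfl

theorem content_support_subset {m : ℕ} {μ : YoungDiagram} (T : BoundedTableau m μ) :
    (content T).support ⊆ Finset.range m := Finsupp.support_onFinset_subset

open Classical in
theorem coeff_schur {n : ℕ} (μ : n.Partition) {d : ℕ →₀ ℕ} {m : ℕ}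
    (hd : d.support ⊆ Finset.range m) : MvPowerSeries.coeff d (schur μ) =
      ∑ T : BoundedTableau m (diagram μ), if content T = d then 1 else 0 := by
  have hb : ∀ T : SemistandardYoungTableau (diagram μ),
      (∀ i, ((diagram μ).cells.filter fun c => T c.1 c.2 = i).card = d i) →
      ∀ i j, (i, j) ∈ diagram μ → T i j < m := by
    intro T hT i j hc
    rw [← Finset.mem_range]
    refine hd (Finsupp.mem_support_iff.mpr ?_)
    rw [← hT, Finset.card_ne_zero]
    exact ⟨(i, j), Finset.mem_filter.mpr ⟨(YoungDiagram.mem_cells _).mpr hc, rfl⟩⟩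
  let e : {T : SemistandardYoungTableau (diagram μ) //
      ∀ i, ((diagram μ).cells.filter fun c => T c.1 c.2 = i).card = d i} ≃
      {T : BoundedTableau m (diagram μ) // content T = d} :=
    { toFun := fun T => ⟨⟨T.1, hb T.1 T.2⟩, Finsupp.ext T.2⟩
      invFun := fun T => ⟨T.1.1, fun i => DFunLike.congr_fun T.2 i⟩
      left_inv := fun _ => rfl
      right_inv := fun _ => rfl }
  change (Nat.card _ : ℚ) = _
  rw [Nat.card_congr e, Nat.card_eq_fintype_card, Fintype.card_subtype, Finset.sum_boole]

theorem coeff_schur_eq_chainWeight {n : ℕ} (μ : n.Partition) {d : ℕ →₀ ℕ} {m : ℕ}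
    (hd : d.support ⊆ Finset.range m) : MvPowerSeries.coeff d (schur μ) =
      chainWeight (contentWeight d) m (diagram μ) := by
  classical
  rw [coeff_schur μ hd, ← sum_boundedTableau]
  refine Finset.sum_congr rfl fun T _ => ?_
  split_ifs with h
  · symm
    refine Finset.prod_eq_one fun i _ => ?_
    rw [contentWeight, if_pos (by rw [← content_apply, h])]
  · obtain ⟨i, hi⟩ := DFunLike.ne_iff.mp h
    symm
    refine Finset.prod_eq_zero (i := i) ?_ (if_neg hi)
    by_contra h2
    apply hi
    rw [Finsupp.notMem_support_iff.mp fun h3 => h2 (content_support_subset T h3),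
      Finsupp.notMem_support_iff.mp fun h3 => h2 (hd h3)]

theorem specOnes_schur {n : ℕ} (μ : n.Partition) (N : ℕ) :
    specOnes N (schur μ) = chainWeight (fun _ _ => 1) N (diagram μ) := by
  classical
  have h1 : ∀ d : ℕ →₀ ℕ, (if d.support ⊆ Finset.range N then
      MvPowerSeries.coeff d (schur μ) else 0) =
      ∑ T : BoundedTableau N (diagram μ), if content T = d then 1 else 0 := by
    intro d
    split_ifs with h
    · exact coeff_schur μ h
    · symm
      refine Finset.sum_eq_zero fun T _ => if_neg ?_
      rintro rfl
      exact h (content_support_subset T)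
  have h2 : specOnes N (schur μ) = ∑ᶠ d : ℕ →₀ ℕ,
      ∑ T : BoundedTableau N (diagram μ), if content T = d then (1 : ℚ) else 0 := by
    rw [specOnes]
    refine finsum_congr fun d => ?_
    rw [← h1]
  rw [h2, ← sum_boundedTableau, finsum_eq_sum_of_support_subset
    (s := Finset.univ.image (content : BoundedTableau N (diagram μ) → _)), Finset.sum_comm]
  · refine Finset.sum_congr rfl fun T _ => ?_
    rw [Finset.sum_ite_eq, if_pos (Finset.mem_image_of_mem _ (Finset.mem_univ _)),
      Finset.prod_const_one]
  · intro d hd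
    obtain ⟨T, -, hT⟩ := Finset.exists_ne_zero_of_sum_ne_zero hd
    rw [Finset.mem_coe, Finset.mem_image]
    refine ⟨T, Finset.mem_univ _, ?_⟩
    by_contra h
    exact hT (if_neg h)

/-- The Cauchy identity, with `N` of the variables of one alphabet set to `1`. -/
theorem coeff_H_pow_schur (N n : ℕ) :
    ((PowerSeries.coeff n (H ^ N) : SymFun) : MvPowerSeries ℕ ℚ) =
      ∑ μ : n.Partition, specOnes N (schur μ) • schur μ := by
  ext d
  obtain ⟨m, hm⟩ : ∃ m, d.support ⊆ Finset.range m :=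
    ⟨d.support.sup id + 1, fun i hi => Finset.mem_range.mpr
      (Nat.lt_succ_of_le (Finset.le_sup (f := id) hi))⟩
  have hdeg : d.degree = ∑ i ∈ Finset.range m, d i :=
    Finset.sum_subset hm fun i _ hi => Finsupp.notMem_support_iff.mp hi
  rw [isVarProd_H.pow (by simp) N, map_sum]
  simp only [map_smul, coeff_schur_eq_chainWeight _ hm, specOnes_schur, smul_eq_mul]
  rw [← sum_diagrams fun μ => chainWeight (fun _ _ => 1) N μ * chainWeight (contentWeight d) m μ]
  split_ifs with h
  · rw [← h, hdeg]
    simp only [mul_comm (chainWeight (fun _ _ => 1) N _)]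
    rw [sum_contentWeight]
    refine Finset.prod_subset hm fun i _ hi => ?_
    rw [Finsupp.notMem_support_iff.mp hi]
    change PowerSeries.coeff 0 ((PowerSeries.mk 1 : PowerSeries ℚ) ^ N) = 1
    rw [PowerSeries.coeff_zero_eq_constantCoeff_apply, map_pow,
      ← PowerSeries.coeff_zero_eq_constantCoeff_apply, PowerSeries.coeff_mk, Pi.one_apply, one_pow]
  · symm
    refine Finset.sum_eq_zero fun μ hμ => ?_
    rw [chainWeight_contentWeight_eq_zero, mul_zero]
    rw [mem_diagrams.mp hμ, ← hdeg]
    exact Ne.symm h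

end Young

theorem len_pos {n : ℕ} (hn : 1 ≤ n) (μ : n.Partition) : 1 ≤ len μ := by
  by_contra h
  have h1 : μ.parts = 0 := Multiset.card_eq_zero.mp (by
    change len μ = 0
    omega)
  have h2 := μ.parts_sum
  rw [h1, Multiset.sum_zero] at h2
  omega

end
end ParkingFunctions

open ParkingFunctions in
theorem theorem2p1 (r k : ℕ) (hr : 1 ≤ r) (hk : 1 ≤ k) :
    F r k 0 = 1 ∧
    (∀ n : ℕ, 1 ≤ n →
      F r k n = ((k : ℚ) / (r * n + k)) • ∑ μ : n.Partition,
          multinomialCoeff (r * n + k) n (mult μ) • homPart μ ∧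
      F r k n = ((k : ℚ) / (r * n + k)) • ∑ μ : n.Partition,
          (sgn μ * multinomialCoeff (r * n + k + len μ - 1) n (mult μ)) • elemPart μ ∧
      F r k n = ((k : ℚ) / (r * n + k)) • ∑ μ : n.Partition,
          ((μ.parts.map fun j => ((j + (r * n + k) - 1).choose j : ℚ)).prod) • monomialSym μ ∧
      (F r k n : MvPowerSeries ℕ ℚ) = ((k : ℚ) / (r * n + k)) • ∑ μ : n.Partition,
          specOnes (r * n + k) (schur μ) • schur μ ∧
      F r k n = (k : ℚ) • ∑ μ : n.Partition,
          ((zee μ)⁻¹ * (r * n + k : ℚ) ^ (len μ - 1)) • powPart μ ∧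
      omega (F r k n) = ((k : ℚ) / (r * n + k)) • ∑ μ : n.Partition,
          ((μ.parts.map fun j => ((r * n + k).choose j : ℚ)).prod) • monomialSym μ) ∧
    ∀ n : ℕ, F r k n = ((k : ℚ) / (r * n + k)) • PowerSeries.coeff n (H ^ (r * n + k)) := by
  refine ⟨?_, fun n hn => ⟨?_, ?_, ?_, ?_, ?_, ?_⟩, F_eq_coeff_H_pow hk⟩
  · have hk0 : (k : ℚ) ≠ 0 := Nat.cast_ne_zero.mpr (by omega)
    have h0 : PowerSeries.coeff 0 (H ^ (r * 0 + k)) = 1 := by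
      rw [PowerSeries.coeff_zero_eq_constantCoeff_apply, map_pow,
        ← PowerSeries.coeff_zero_eq_constantCoeff_apply, H, PowerSeries.coeff_mk, homSym_zero,
        one_pow]
    rw [F_eq_coeff_H_pow hk, h0, Nat.cast_zero, mul_zero, zero_add, div_self hk0, one_smul]
  · rw [F_eq_coeff_H_pow hk, coeff_H_pow_hom]
  · rw [F_eq_coeff_H_pow hk, coeff_H_pow_elem (by omega)]
  · rw [F_eq_coeff_H_pow hk, coeff_H_pow_monomial (by omega)]
  · rw [F_eq_coeff_H_pow hk, ← Young.coeff_H_pow_schur]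
    rfl
  · have hM : (r * n + k : ℚ) ≠ 0 := by
      have : ((r * n + k : ℕ) : ℚ) ≠ 0 := Nat.cast_ne_zero.mpr (by omega)
      exact_mod_cast this
    rw [F_eq_coeff_H_pow hk, coeff_H_pow_power, Finset.smul_sum, Finset.smul_sum]
    refine Finset.sum_congr rfl fun μ _ => ?_
    obtain ⟨l, hl⟩ : ∃ l, len μ = l + 1 := ⟨len μ - 1, by have := len_pos hn μ; omega⟩
    rw [smul_smul, smul_smul, hl, Nat.add_sub_cancel]
    push_cast
    congr 1
    field_simp
    ring
  · rw [F_eq_coeff_H_pow hk, map_smul, omega_coeff_H_pow, coeff_E_pow_monomial]
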